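/- Let $0<a<b$, $\sigma_1,\sigma_2>0$, $\varrho\in(-1,1)$, $\Sigma=\begin{pmatrix}\sigma_1^2&\sigma_1\sigma_2\varrho\\ \sigma_1\sigma_2\varrho&\sigma_2^2\end{pmatrix}$, and let $\Sigma^{1/2}$ be its positive semidefinite square root. Let $F:[a,b]\to\mathbb{R}^{p\times 2}$ be continuously differentiable with derivative $\dot F$, let $\varepsilon=(\varepsilon_1,\varepsilon_2)^\top$ consist of two independent standard Brownian motions, and for $\theta\in\mathbb{R}^p$ consider the observed process $$Y(t)=F(t)^\top\theta+\Sigma^{1/2}\varepsilon(t),\qquad t\in[a,b].$$ Put $$M_0=\int_a^b\dot F(s)\Sigma^{-1}\dot F(s)^\top ds,\qquad M=M_0+\tfrac1a F(a)\Sigma^{-1}F(a)^\top ,$$ and assume that $M$ is non-singular. An estimator $T$ (a function of $Y$) is unbiased if $\mathbb{E}_\theta[T]=\theta$ for all $\theta\in\mathbb{R}^p$. An estimator is linear if it is of the form $\int_a^b G(s)\,dY(s)+H\,Y(a)$ with $G\in L^2([a,b];\mathbb{R}^{p\times 2})$ and $H\in\mathbb{R}^{p\times 2}$ deterministic and independent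 of $\theta$; here the stochastic integral is the $L^2$-limit of the integrals of step functions approximating $G$ in $L^2([a,b])$. The case $H=0$ gives the estimators $\int_a^b G(s)\,dY(s)$. (i) Let $n\ge 2$, $a=t_1<t_2<\dots<t_n=b$, and let $\Phi_2,\dots,\Phi_n$ be real $p\times 2$ matrices. The estimator $$\hat\theta_n=M^{-1}\Big\{\sum_{i=2}^n\Phi_i\Sigma^{-1}\big(Y(t_i)-Y(t_{i-1})\big)+\tfrac1aF(a)\Sigma^{-1}Y(a)\Big\}$$ is unbiased if and only if $$M_0=\sum_{i=2}^n\Phi_i\Sigma^{-1}\int_{t_{i-1}}^{t_i}\dot F(s)^\top ds=\sum_{i=2}^n\Phi_i\Sigma^{-1}\big(F(t_i)-F(t_{i-1})\big)^\top ,$$ where the second equality always holds. (ii) Let $$\hat\theta_{\rm BLUE}=M^{-1}\Big\{\int_a^b\dot F(s)\Sigma^{-1}\,dY(s)+\tfrac1aF(a)\Sigma^{-1}Y(a)\Big\}.$$ This is the best linear unbiased estimator: it is linear and unbiased, and for every linear unbiased estimator $\tilde\theta$ and every $\theta$ the matrix $\mathbb{E}_\theta[(\tilde\theta-\theta)(\tilde\theta-\theta)^\top]-\mathbb{E}_\theta[(\hat\theta_{\rm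 BLUE}-\theta)(\hat\theta_{\rm BLUE}-\theta)^\top]$ is positive semidefinite. Moreover, for every linear unbiased estimator $\tilde\theta$ and every $\theta\in\mathbb{R}^p$, the components of $\tilde\theta$ and $\hat\theta_{\rm BLUE}$ are square integrable and $$\mathbb{E}_\theta\big[(\tilde\theta-\theta)(\tilde\theta-\theta)^\top\big]=\mathbb{E}_\theta\big[(\tilde\theta-\hat\theta_{\rm BLUE})(\tilde\theta-\hat\theta_{\rm BLUE})^\top\big]+M^{-1}.$$ -/

import Mathlib

open MeasureTheory ProbabilityTheory Filter Topology
open scoped NNReal ENNReal Matrix MatrixOrder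

noncomputable section

namespace TwoGroup

/-! ### Deterministic quantities of the model -/

/-- The covariance matrix `Σ` with standard deviations `σ₁, σ₂` and correlation `ρ`. -/
def Sig (σ₁ σ₂ ρ : ℝ) : Matrix (Fin 2) (Fin 2) ℝ :=
  !![σ₁ ^ 2, σ₁ * σ₂ * ρ; σ₁ * σ₂ * ρ, σ₂ ^ 2]

/-- The positive semidefinite square root `Σ^{1/2}`. -/
def sqrtSig (σ₁ σ₂ ρ : ℝ) : Matrix (Fin 2) (Fin 2) ℝ :=
  CFC.sqrt (Sig σ₁ σ₂ ρ)

/-- The entrywise integral `∫_a^b A(s) ds` of a matrix valued function. -/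
def matInt {m n : Type*} (a b : ℝ) (A : ℝ → Matrix m n ℝ) : Matrix m n ℝ :=
  Matrix.of fun i j => ∫ s in a..b, A s i j

/-- The entrywise derivative of a matrix valued function on `[a, b]` (one-sided at the two end
points). -/
def matDeriv {m n : Type*} (a b : ℝ) (F : ℝ → Matrix m n ℝ) (t : ℝ) : Matrix m n ℝ :=
  Matrix.of fun i j => derivWithin (fun s => F s i j) (Set.Icc a b) t

/-- `F` is continuously differentiable on `[a, b]`. -/
def IsC1 {m n : Type*} (a b : ℝ) (F : ℝ → Matrix m n ℝ) : Prop :=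
  ∀ i j, ContDiffOn ℝ 1 (fun t => F t i j) (Set.Icc a b)

/-- `M₀ = ∫_a^b Ḟ Σ⁻¹ Ḟᵀ ds`, where `S` stands for `Σ`. -/
def infoM0 {p : ℕ} (a b : ℝ) (F : ℝ → Matrix (Fin p) (Fin 2) ℝ) (S : Matrix (Fin 2) (Fin 2) ℝ) :
    Matrix (Fin p) (Fin p) ℝ :=
  matInt a b fun s => matDeriv a b F s * S⁻¹ * (matDeriv a b F s)ᵀ

/-- `M = ∫_a^b Ḟ Σ⁻¹ Ḟᵀ ds + (1/a) F(a) Σ⁻¹ F(a)ᵀ`. -/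
def infoM {p : ℕ} (a b : ℝ) (F : ℝ → Matrix (Fin p) (Fin 2) ℝ) (S : Matrix (Fin 2) (Fin 2) ℝ) :
    Matrix (Fin p) (Fin p) ℝ :=
  infoM0 a b F S + (1 / a) • (F a * S⁻¹ * (F a)ᵀ)

/-! ### The observed process -/

variable {Ω : Type*} [MeasurableSpace Ω]

/-- `ε₁, ε₂` are independent standard Brownian motions. -/
def IsBrownianPair (ε : Fin 2 → ℝ≥0 → Ω → ℝ) (P : Measure Ω) : Prop :=
  (∀ k, IsBrownianReal (ε k) P) ∧ iIndepFun (fun k ω t => ε k t ω) P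

/-- The observed process `Y(t) = F(t)ᵀ θ + R ε(t)` under the parameter `θ`, with `R = Σ^{1/2}`.
It is only used at times `t > 0`. -/
def obs {p : ℕ} (F : ℝ → Matrix (Fin p) (Fin 2) ℝ) (R : Matrix (Fin 2) (Fin 2) ℝ)
    (ε : Fin 2 → ℝ≥0 → Ω → ℝ) (θ : Fin p → ℝ) (t : ℝ) (ω : Ω) : Fin 2 → ℝ :=
  (F t)ᵀ *ᵥ θ + R *ᵥ (fun k => ε k t.toNNReal ω)

/-! ### Stochastic integrals of deterministic square integrable functions -/

/-- A step function `∑ₖ cₖ 1_{(lₖ, rₖ]}` with all intervals inside `[a, b]`. -/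
structure StepFn (a b : ℝ) where
  m : ℕ
  c : Fin m → ℝ
  l : Fin m → ℝ
  r : Fin m → ℝ
  a_le : ∀ k, a ≤ l k
  l_le_r : ∀ k, l k ≤ r k
  le_b : ∀ k, r k ≤ b

/-- The function defined by a step function. -/
def StepFn.eval {a b : ℝ} (s : StepFn a b) (t : ℝ) : ℝ :=
  ∑ k, (Set.Ioc (s.l k) (s.r k)).indicator (fun _ => s.c k) t

/-- The elementary integral `∑ₖ cₖ (X(rₖ) - X(lₖ))` of a step function. -/
def StepFn.integral {a b : ℝ} (s : StepFn a b) (X : ℝ → Ω → ℝ) (ω : Ω) : ℝ :=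
  ∑ k, s.c k * (X (s.r k) ω - X (s.l k) ω)

/-- `I` is (a version of) `∫_a^b g dX`: the `L²(P)`-limit of the elementary integrals of step
functions converging to `g` in `L²([a, b])`. -/
def IsStochInt (P : Measure Ω) (a b : ℝ) (g : ℝ → ℝ) (X : ℝ → Ω → ℝ) (I : Ω → ℝ) : Prop :=
  MemLp I 2 P ∧ ∃ s : ℕ → StepFn a b,
    Tendsto (fun n => eLpNorm (fun t => (s n).eval t - g t) 2 (volume.restrict (Set.Icc a b)))
      atTop (𝓝 0) ∧
    Tendsto (fun n => eLpNorm (fun ω => (s n).integral X ω - I ω) 2 P) atTop (𝓝 0)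

open Classical in
/-- The stochastic integral `∫_a^b g dX` (a chosen version; `0` if there is none, which does not
happen for `g ∈ L²([a, b])` and `X` a Brownian motion plus a `C¹` drift). -/
def stochInt (P : Measure Ω) (a b : ℝ) (g : ℝ → ℝ) (X : ℝ → Ω → ℝ) : Ω → ℝ :=
  if h : ∃ I, IsStochInt P a b g X I then h.choose else fun _ => 0

/-- The stochastic integral `∫_a^b G dX` of a `p × 2` matrix function against a two-dimensional
process. -/
def matStochInt {p : ℕ} (P : Measure Ω) (a b : ℝ) (G : ℝ → Matrix (Fin p) (Fin 2) ℝ)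
    (X : ℝ → Ω → Fin 2 → ℝ) (ω : Ω) : Fin p → ℝ :=
  fun i => ∑ k, stochInt P a b (fun t => G t i k) (fun t ω' => X t ω' k) ω

/-! ### Estimators

An estimator evaluated under each parameter value is a family `T : (Fin p → ℝ) → Ω → Fin p → ℝ`:
`T θ` is the estimator computed from the data `Y θ` that the parameter `θ` generates. -/

/-- Unbiasedness: `E_θ[T] = θ` for every `θ`. -/
def IsUnbiased {p : ℕ} (P : Measure Ω) (T : (Fin p → ℝ) → Ω → Fin p → ℝ) : Prop :=
  ∀ θ i, Integrable (fun ω => T θ ω i) P ∧ ∫ ω, T θ ω i ∂P = θ i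

/-- `E[(U - V)(U - V)ᵀ]`. -/
def mse {p : ℕ} (P : Measure Ω) (U V : Ω → Fin p → ℝ) : Matrix (Fin p) (Fin p) ℝ :=
  Matrix.of fun i j => ∫ ω, (U ω i - V ω i) * (U ω j - V ω j) ∂P

/-- Linear estimators: `∫_a^b G dY + H Y(a)` with `G ∈ L²([a, b])` and a constant matrix `H`
(up to null sets), where `G` and `H` do not depend on `θ`. -/
def IsLinearEst {p : ℕ} (P : Measure Ω) (a b : ℝ) (Y : (Fin p → ℝ) → ℝ → Ω → Fin 2 → ℝ)
    (T : (Fin p → ℝ) → Ω → Fin p → ℝ) : Prop :=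
  ∃ (G : ℝ → Matrix (Fin p) (Fin 2) ℝ) (H : Matrix (Fin p) (Fin 2) ℝ),
    (∀ i k, MemLp (fun t => G t i k) 2 (volume.restrict (Set.Icc a b))) ∧
    ∀ θ, T θ =ᵐ[P] fun ω => matStochInt P a b G (Y θ) ω + H *ᵥ Y θ a ω

/-- Best linear unbiased estimator: linear, unbiased, and with the smallest mean squared error
matrix, in the Loewner order and for every `θ`, among all linear unbiased estimators. -/
def IsBLUE {p : ℕ} (P : Measure Ω) (a b : ℝ) (Y : (Fin p → ℝ) → ℝ → Ω → Fin 2 → ℝ)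
    (T : (Fin p → ℝ) → Ω → Fin p → ℝ) : Prop :=
  IsLinearEst P a b Y T ∧ IsUnbiased P T ∧
    ∀ T', IsLinearEst P a b Y T' → IsUnbiased P T' →
      ∀ θ, (mse P (T' θ) (fun _ => θ) - mse P (T θ) (fun _ => θ)).PosSemidef

/-- The continuous time estimator
`θ̂_BLUE = M⁻¹ (∫_a^b Ḟ Σ⁻¹ dY + (1/a) F(a) Σ⁻¹ Y(a))` computed from the process `X`. -/
def blue {p : ℕ} (P : Measure Ω) (a b : ℝ) (F : ℝ → Matrix (Fin p) (Fin 2) ℝ)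
    (S : Matrix (Fin 2) (Fin 2) ℝ) (X : ℝ → Ω → Fin 2 → ℝ) (ω : Ω) : Fin p → ℝ :=
  (infoM a b F S)⁻¹ *ᵥ
    (matStochInt P a b (fun t => matDeriv a b F t * S⁻¹) X ω
      + ((1 / a) • (F a * S⁻¹)) *ᵥ X a ω)

/-- The discrete estimator
`θ̂_n = M⁻¹ (∑_{i=2}^n Φᵢ Σ⁻¹ (Y(tᵢ) - Y(tᵢ₋₁)) + (1/a) F(a) Σ⁻¹ Y(a))` computed from the
process `X`. -/
def discreteEst {p : ℕ} (a b : ℝ) (F : ℝ → Matrix (Fin p) (Fin 2) ℝ)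
    (S : Matrix (Fin 2) (Fin 2) ℝ) (n : ℕ) (t : ℕ → ℝ) (Φ : ℕ → Matrix (Fin p) (Fin 2) ℝ)
    (X : ℝ → Ω → Fin 2 → ℝ) (ω : Ω) : Fin p → ℝ :=
  (infoM a b F S)⁻¹ *ᵥ
    (∑ i ∈ Finset.Icc 2 n, (Φ i * S⁻¹) *ᵥ (X (t i) ω - X (t (i - 1)) ω)
      + ((1 / a) • (F a * S⁻¹)) *ᵥ X a ω)

end TwoGroup

end

open TwoGroup

/-! Only first and second moments enter. With `S = Σ`, the components of Y satisfy cov(Y_k(s),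
Y_l(t)) = S_kl min(s, t). For step functions, and then by L² limits, this gives the isometry cov(∫g
dY_k, ∫f dY_l) = S_kl ∫ g f. Increments after time a are uncorrelated with Y(a). Hence two linear
functionals with weights (G, H) and (G', H') have covariance ∫ G S G'ᵀ + a H S H'ᵀ
(`covariance_linFun`), while the mean of the first is (∫ G Ḟᵀ + H F(a)ᵀ) θ (`integral_linFun_obs`).
Unbiasedness thus means that this matrix, `meanMatrix`, is the identity.

The weights M⁻¹ Ḟ S⁻¹ and M⁻¹ F(a) S⁻¹ / a are the Riesz representers of the unbiasedness
constraint: the factors S and a cancel, so the covariance of any linear functional with the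
candidate is its mean matrix times M⁻¹ (`covariance_linFun_blue`). For an unbiased T this is M⁻¹,
whichever T is chosen. In particular the candidate B has covariance M⁻¹, and T - B is uncorrelated
with B. Pythagoras gives the mean squared error identity (`mse_linFun`), and optimality follows
because the matrix for T - B is positive semidefinite.

The discrete criterion needs only expectations of increments and cancellation of the common term
F(a) S⁻¹ F(a)ᵀ / a. -/

section SquareIntegrable

/-! ### Inner products and their limits in L². -/

variable {α : Type*} [MeasurableSpace α] {μ : Measure α}

theorem real_inner_toLp {f g : α → ℝ} (hf : MemLp f 2 μ) (hg : MemLp g 2 μ) :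
    inner ℝ (hf.toLp f) (hg.toLp g) = ∫ x, f x * g x ∂μ := by
  rw [L2.inner_def]
  refine integral_congr_ae ?_
  filter_upwards [hf.coeFn_toLp, hg.coeFn_toLp] with x h1 h2
  rw [h1, h2, real_inner_eq_re_inner]
  simp [mul_comm]

theorem norm_toLp_sq {f : α → ℝ} (hf : MemLp f 2 μ) :
    ‖hf.toLp f‖ ^ 2 = ∫ x, f x ^ 2 ∂μ := by
  rw [← real_inner_self_eq_norm_sq, real_inner_toLp]
  simp only [pow_two]

theorem sq_integral_mul_le {f g : α → ℝ} (hf : MemLp f 2 μ) (hg : MemLp g 2 μ) :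
    (∫ x, f x * g x ∂μ) ^ 2 ≤ (∫ x, f x ^ 2 ∂μ) * ∫ x, g x ^ 2 ∂μ := by
  rw [← norm_toLp_sq hf, ← norm_toLp_sq hg, ← real_inner_toLp hf hg, ← mul_pow]
  exact sq_le_sq' (by linarith [neg_le_of_abs_le (abs_real_inner_le_norm (hf.toLp f) (hg.toLp g))])
    (real_inner_le_norm _ _)

/-- Continuity of the L² inner product. Every passage from step functions to general integrands
below goes through it; means are the case where one factor is the constant 1. -/
theorem tendsto_integral_mul_of_tendsto_eLpNorm {f g : ℕ → α → ℝ} {f' g' : α → ℝ}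
    (hf : ∀ n, MemLp (f n) 2 μ) (hf' : MemLp f' 2 μ)
    (hg : ∀ n, MemLp (g n) 2 μ) (hg' : MemLp g' 2 μ)
    (hff' : Tendsto (fun n => eLpNorm (fun x => f n x - f' x) 2 μ) atTop (𝓝 0))
    (hgg' : Tendsto (fun n => eLpNorm (fun x => g n x - g' x) 2 μ) atTop (𝓝 0)) :
    Tendsto (fun n => ∫ x, f n x * g n x ∂μ) atTop (𝓝 (∫ x, f' x * g' x ∂μ)) := by
  have h1 := (Lp.tendsto_Lp_iff_tendsto_eLpNorm'' f hf f' hf').2 hff'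
  have h2 := (Lp.tendsto_Lp_iff_tendsto_eLpNorm'' g hg g' hg').2 hgg'
  have h3 := Filter.Tendsto.inner (𝕜 := ℝ) h1 h2
  simpa only [real_inner_toLp] using h3

theorem tendsto_eLpNorm_self_sub (f : α → ℝ) :
    Tendsto (fun _ : ℕ => eLpNorm (fun x => f x - f x) 2 μ) atTop (𝓝 0) := by
  simp

end SquareIntegrable

/-! ### Algebra of step functions and their density in L²([a, b]). -/

namespace TwoGroup.StepFn

variable {Ω : Type*} [MeasurableSpace Ω] {P : Measure Ω} {a b : ℝ}

theorem l_mem (s : StepFn a b) (k : Fin s.m) : s.l k ∈ Set.Icc a b :=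
  ⟨s.a_le k, (s.l_le_r k).trans (s.le_b k)⟩

theorem r_mem (s : StepFn a b) (k : Fin s.m) : s.r k ∈ Set.Icc a b :=
  ⟨(s.a_le k).trans (s.l_le_r k), s.le_b k⟩

/-- The scalar multiple of a step function. -/
def smul (x : ℝ) (s : StepFn a b) : StepFn a b where
  m := s.m
  c k := x * s.c k
  l := s.l
  r := s.r
  a_le := s.a_le
  l_le_r := s.l_le_r
  le_b := s.le_b

/-- The sum of two step functions. -/
def add (s t : StepFn a b) : StepFn a b where
  m := s.m + t.m
  c := Fin.append s.c t.c
  l := Fin.append s.l t.l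
  r := Fin.append s.r t.r
  a_le k := by
    refine Fin.addCases (fun i => ?_) (fun i => ?_) k
    · simpa using s.a_le i
    · simpa using t.a_le i
  l_le_r k := by
    refine Fin.addCases (fun i => ?_) (fun i => ?_) k
    · simpa using s.l_le_r i
    · simpa using t.l_le_r i
  le_b k := by
    refine Fin.addCases (fun i => ?_) (fun i => ?_) k
    · simpa using s.le_b i
    · simpa using t.le_b i

theorem eval_smul (x : ℝ) (s : StepFn a b) (u : ℝ) : (s.smul x).eval u = x * s.eval u := by
  simp only [eval, smul, Finset.mul_sum, Set.indicator_apply, mul_ite, mul_zero]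
  rfl

theorem integral_smul {Ω : Type*} (x : ℝ) (s : StepFn a b) (X : ℝ → Ω → ℝ) (ω : Ω) :
    (s.smul x).integral X ω = x * s.integral X ω := by
  simp only [integral, smul, Finset.mul_sum, mul_assoc]
  rfl

theorem eval_add (s t : StepFn a b) (u : ℝ) : (s.add t).eval u = s.eval u + t.eval u := by
  unfold eval add
  refine (Fin.sum_univ_add (a := s.m) (b := t.m) _).trans ?_
  simp only [Fin.append_left, Fin.append_right]

theorem integral_add {Ω : Type*} (s t : StepFn a b) (X : ℝ → Ω → ℝ) (ω : Ω) :
    (s.add t).integral X ω = s.integral X ω + t.integral X ω := by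
  unfold integral add
  refine (Fin.sum_univ_add (a := s.m) (b := t.m) _).trans ?_
  simp only [Fin.append_left, Fin.append_right]

theorem memLp_eval (s : StepFn a b) : MemLp s.eval 2 (volume.restrict (Set.Icc a b)) := by
  unfold eval
  refine memLp_finsetSum _ fun k _ => ?_
  exact (memLp_const (s.c k)).indicator measurableSet_Ioc

theorem memLp_integral (s : StepFn a b) {X : ℝ → Ω → ℝ}
    (hX : ∀ t ∈ Set.Icc a b, MemLp (X t) 2 P) : MemLp (s.integral X) 2 P := by
  unfold integral
  refine memLp_finsetSum _ fun k _ => ?_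
  exact ((hX _ (s.r_mem k)).sub (hX _ (s.l_mem k))).const_mul _

theorem integral_eval_mul (s : StepFn a b) {f : ℝ → ℝ}
    (hf : IntegrableOn f (Set.Icc a b)) :
    ∫ u in Set.Icc a b, s.eval u * f u = ∑ k, s.c k * ∫ u in s.l k..s.r k, f u := by
  have key : ∀ k u, (Set.Ioc (s.l k) (s.r k)).indicator (fun _ => s.c k) u * f u
      = (Set.Ioc (s.l k) (s.r k)).indicator (fun u => s.c k * f u) u := by
    intro k u
    simp only [Set.indicator_apply, ite_mul, zero_mul]
  simp only [eval, Finset.sum_mul, key]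
  rw [integral_finsetSum]
  · refine Finset.sum_congr rfl fun k _ => ?_
    rw [setIntegral_indicator measurableSet_Ioc, Set.inter_eq_right.2,
      intervalIntegral.integral_of_le (s.l_le_r k), integral_const_mul]
    exact fun u hu => ⟨(s.a_le k).trans hu.1.le, hu.2.trans (s.le_b k)⟩
  · exact fun k _ => (hf.const_mul _).indicator measurableSet_Ioc

/-- The step function that takes on the `k`-th of `N` equal pieces of `[a, b]` the value of `f` at
the left end point of the piece. -/
noncomputable def sample (hab : a ≤ b) (f : ℝ → ℝ) (N : ℕ) : StepFn a b where
  m := N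
  c k := f (a + k * ((b - a) / N))
  l k := a + k * ((b - a) / N)
  r k := a + (k + 1) * ((b - a) / N)
  a_le k := by
    have : 0 ≤ (b - a) / N := div_nonneg (sub_nonneg.2 hab) (by positivity)
    have := mul_nonneg (Nat.cast_nonneg (α := ℝ) k) this
    linarith
  l_le_r k := by
    have : 0 ≤ (b - a) / N := div_nonneg (sub_nonneg.2 hab) (by positivity)
    linarith
  le_b k := by
    have h0 : 0 ≤ (b - a) / N := div_nonneg (sub_nonneg.2 hab) (by positivity)
    have h1 : ((k : ℕ) : ℝ) + 1 ≤ N := by exact_mod_cast k.2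
    have hN : (N : ℝ) ≠ 0 := by
      have := Nat.cast_nonneg (α := ℝ) k
      intro h; linarith
    have h2 := mul_le_mul_of_nonneg_right h1 h0
    have h3 : (N : ℝ) * ((b - a) / N) = b - a := by field_simp
    linarith

theorem exists_eval_sample (hab : a < b) (f : ℝ → ℝ) {N : ℕ} (hN : 0 < N) {u : ℝ}
    (hu : u ∈ Set.Ioc a b) :
    ∃ v ∈ Set.Icc a b, |v - u| ≤ (b - a) / N ∧ (sample hab.le f N).eval u = f v := by
  have hN' : (0 : ℝ) < N := by exact_mod_cast hN
  set h := (b - a) / N with hh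
  have h0 : 0 < h := div_pos (sub_pos.2 hab) hN'
  have hNh : N * h = b - a := by rw [hh]; field_simp
  -- The pieces are open on the left and closed on the right, so the index of the piece containing u
  -- is a ceiling minus one; it is a natural number because u > a.
  obtain ⟨k, hk⟩ : ∃ k : ℕ, ⌈(u - a) / h⌉₊ = k + 1 :=
    Nat.exists_eq_succ_of_ne_zero (Nat.ceil_pos.2 (div_pos (sub_pos.2 hu.1) h0)).ne'
  have hk1 : k < (u - a) / h := Nat.lt_ceil.1 (by omega)
  have hk2 : (u - a) / h ≤ k + 1 := by
    have := Nat.le_ceil ((u - a) / h)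
    rw [hk] at this
    exact_mod_cast this
  rw [lt_div_iff₀ h0] at hk1
  rw [div_le_iff₀ h0] at hk2
  have hkN : k < N := by
    have : (k : ℝ) * h < N * h := by linarith [hu.2]
    exact_mod_cast lt_of_mul_lt_mul_right this h0.le
  refine ⟨a + k * h, (sample hab.le f N).l_mem ⟨k, hkN⟩, ?_, ?_⟩
  · rw [abs_le]; constructor <;> linarith
  · unfold eval
    refine (Finset.sum_eq_single (⟨k, hkN⟩ : Fin N) ?_ ?_).trans ?_
    · rintro j - hj
      refine Set.indicator_of_notMem (fun hju => hj ?_) _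
      obtain ⟨h1, h2⟩ := hju
      simp only [sample, ← hh] at h1 h2
      have e1 : ((j : ℕ) : ℝ) * h < (k + 1) * h := by linarith
      have e2 : (k : ℝ) * h < ((j : ℕ) + 1) * h := by linarith
      have e1' := lt_of_mul_lt_mul_right e1 h0.le
      have e2' := lt_of_mul_lt_mul_right e2 h0.le
      have e3 : (j : ℕ) < k + 1 := by exact_mod_cast e1'
      have e4 : k < (j : ℕ) + 1 := by exact_mod_cast e2'
      exact Fin.ext (by simp only; omega)
    · exact fun hk' => absurd (Finset.mem_univ _) hk'
    · rw [Set.indicator_of_mem]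
      · rfl
      · exact ⟨by simp only [sample, ← hh]; linarith, by simp only [sample, ← hh]; linarith⟩

theorem exists_eLpNorm_eval_sub_le_of_continuous (hab : a < b) {f : ℝ → ℝ} (hf : Continuous f)
    {δ : ℝ} (hδ : 0 < δ) :
    ∃ s : StepFn a b, eLpNorm (fun t => s.eval t - f t) 2 (volume.restrict (Set.Icc a b))
      ≤ ENNReal.ofReal δ := by
  have huc : UniformContinuousOn f (Set.Icc a b) :=
    isCompact_Icc.uniformContinuousOn_of_continuous hf.continuousOn
  have hL : 0 < √(b - a) := Real.sqrt_pos.2 (sub_pos.2 hab)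
  -- A uniform error of δ / √(b - a) becomes an L² error of δ on an interval of length b - a.
  obtain ⟨η, hη, hfη⟩ := Metric.uniformContinuousOn_iff.1 huc (δ / √(b - a)) (by positivity)
  obtain ⟨N, hN⟩ := exists_nat_gt ((b - a) / η)
  have hN0 : (0 : ℝ) < N := lt_trans (div_pos (sub_pos.2 hab) hη) hN
  have hNη : (b - a) / N < η := by
    rw [div_lt_iff₀ hη] at hN
    rw [div_lt_iff₀ hN0]; linarith
  refine ⟨sample hab.le f N, ?_⟩
  have hbd : ∀ᵐ t ∂(volume.restrict (Set.Icc a b)),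
      ‖(sample hab.le f N).eval t - f t‖ ≤ δ / √(b - a) := by
    rw [← restrict_Ioc_eq_restrict_Icc]
    filter_upwards [ae_restrict_mem measurableSet_Ioc] with t ht
    obtain ⟨v, hv, hvt, he⟩ := exists_eval_sample hab f (by exact_mod_cast hN0 : 0 < N) ht
    rw [he, ← dist_eq_norm]
    exact (hfη v hv t ⟨ht.1.le, ht.2⟩ (by rw [Real.dist_eq]; linarith)).le
  refine (eLpNorm_le_of_ae_bound hbd).trans (le_of_eq ?_)
  rw [Measure.restrict_apply_univ, Real.volume_Icc, ENNReal.ofReal_rpow_of_pos (sub_pos.2 hab),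
    ← ENNReal.ofReal_mul (by positivity)]
  congr 1
  rw [Real.sqrt_eq_rpow] at hL ⊢
  rw [ENNReal.toReal_ofNat, ← one_div]
  field_simp

theorem exists_eLpNorm_eval_sub_le (hab : a < b) {g : ℝ → ℝ}
    (hg : MemLp g 2 (volume.restrict (Set.Icc a b))) {δ : ℝ} (hδ : 0 < δ) :
    ∃ s : StepFn a b, eLpNorm (fun t => s.eval t - g t) 2 (volume.restrict (Set.Icc a b))
      ≤ ENNReal.ofReal δ := by
  obtain ⟨f, hf, hf2⟩ := hg.exists_boundedContinuous_eLpNorm_sub_le (by simp)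
    (ε := ENNReal.ofReal (δ / 2)) (by simpa using hδ)
  obtain ⟨s, hs⟩ := exists_eLpNorm_eval_sub_le_of_continuous hab f.continuous (half_pos hδ)
  refine ⟨s, ?_⟩
  have h1 : (fun t => s.eval t - g t) = (fun t => s.eval t - f t) - (g - f) := by
    ext t; simp
  rw [h1]
  refine (eLpNorm_sub_le (s.memLp_eval.sub hf2).1 (hg.sub hf2).1 (by norm_num)).trans ?_
  refine (add_le_add hs hf).trans (le_of_eq ?_)
  rw [← ENNReal.ofReal_add (by positivity) (by positivity), add_halves]

theorem exists_seq_tendsto (hab : a < b) {g : ℝ → ℝ}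
    (hg : MemLp g 2 (volume.restrict (Set.Icc a b))) :
    ∃ s : ℕ → StepFn a b,
      Tendsto (fun n => eLpNorm (fun t => (s n).eval t - g t) 2 (volume.restrict (Set.Icc a b)))
        atTop (𝓝 0) := by
  choose s hs using fun n : ℕ => exists_eLpNorm_eval_sub_le hab hg
    (δ := 1 / ((n : ℝ) + 1)) (by positivity)
  refine ⟨s, tendsto_of_tendsto_of_tendsto_of_le_of_le tendsto_const_nhds ?_
    (fun _ => zero_le) hs⟩
  have := ENNReal.tendsto_ofReal (tendsto_one_div_add_atTop_nhds_zero_nat (𝕜 := ℝ))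
  simpa using this

end TwoGroup.StepFn

/-! ### Calculus of C¹ drifts on [a, b]. -/

section Derivative

variable {a b : ℝ} {d : ℝ → ℝ}

theorem ContDiffOn.integral_derivWithin_Icc (hab : a < b) (hd : ContDiffOn ℝ 1 d (Set.Icc a b))
    {l r : ℝ} (hl : a ≤ l) (hlr : l ≤ r) (hr : r ≤ b) :
    ∫ u in l..r, derivWithin d (Set.Icc a b) u = d r - d l := by
  have hsub : Set.Icc l r ⊆ Set.Icc a b := Set.Icc_subset_Icc hl hr
  have hc := hd.continuousOn_derivWithin (uniqueDiffOn_Icc hab) le_rfl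
  refine intervalIntegral.integral_eq_sub_of_hasDerivAt_of_le hlr (hd.continuousOn.mono hsub)
    (fun x hx => ?_) ?_
  · have hx' : x ∈ Set.Icc a b := hsub ⟨hx.1.le, hx.2.le⟩
    exact ((hd.differentiableOn one_ne_zero x hx').hasDerivWithinAt).hasDerivAt
      (Icc_mem_nhds (hl.trans_lt hx.1) (hx.2.trans_le hr))
  · exact (hc.mono (by rwa [Set.uIcc_of_le hlr])).intervalIntegrable

theorem ContDiffOn.memLp_derivWithin_Icc (hab : a < b) (hd : ContDiffOn ℝ 1 d (Set.Icc a b))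
    (q : ℝ≥0∞) : MemLp (derivWithin d (Set.Icc a b)) q (volume.restrict (Set.Icc a b)) := by
  have hc := hd.continuousOn_derivWithin (uniqueDiffOn_Icc hab) le_rfl
  obtain ⟨C, hC⟩ := isCompact_Icc.exists_bound_of_continuousOn hc
  refine MemLp.of_bound (hc.aestronglyMeasurable measurableSet_Icc) C ?_
  filter_upwards [ae_restrict_mem measurableSet_Icc] with x hx using hC x hx

/-- Turns differences of the kernel min(u, ·) into integrals of indicators, which is how the
Brownian covariance becomes an L² inner product. -/
theorem integral_indicator_Iic {l r : ℝ} (hlr : l ≤ r) (u : ℝ) :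
    ∫ v in l..r, (Set.Iic u).indicator (fun _ => (1 : ℝ)) v = min u r - min u l := by
  rw [intervalIntegral.integral_of_le hlr, integral_indicator_const _ measurableSet_Iic,
    Measure.real, Measure.restrict_apply measurableSet_Iic, Set.inter_comm, Set.Ioc_inter_Iic,
    Real.volume_Ioc, smul_eq_mul, mul_one, ENNReal.toReal_ofReal', inf_comm]
  simp only [min_def, max_def]
  split_ifs <;> linarith

end Derivative

/-! ### Moments of elementary integrals. -/

namespace TwoGroup

variable {Ω : Type*} [MeasurableSpace Ω] {P : Measure Ω} {a b c : ℝ} {X X' : ℝ → Ω → ℝ}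
  {d d' : ℝ → ℝ} {Z : Ω → ℝ}

/-- `X` is square integrable on `[a, b]` with mean function `d`. -/
structure IsSquareIntegrableOn (P : Measure Ω) (a b : ℝ) (X : ℝ → Ω → ℝ) (d : ℝ → ℝ) : Prop where
  memLp : ∀ t ∈ Set.Icc a b, MemLp (X t) 2 P
  mean : ∀ t ∈ Set.Icc a b, ∫ ω, X t ω ∂P = d t

/-- The cross covariance function of `X` and `X'` on `[a, b]` is `c * min s t`. -/
def HasMinCovariance (P : Measure Ω) (a b : ℝ) (X X' : ℝ → Ω → ℝ) (c : ℝ) : Prop :=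
  ∀ s ∈ Set.Icc a b, ∀ t ∈ Set.Icc a b, cov[X s, X' t; P] = c * min s t

namespace StepFn

theorem integral_eval_Iic (s : StepFn a b) {u : ℝ} (hu : u ∈ Set.Icc a b) :
    ∫ v in a..u, s.eval v = ∑ k, s.c k * (min u (s.r k) - min u (s.l k)) := by
  have h := s.integral_eval_mul (f := (Set.Iic u).indicator fun _ => (1 : ℝ))
    ((integrable_const _).indicator measurableSet_Iic)
  simp only [integral_indicator_Iic (s.l_le_r _)] at h
  rw [← h, intervalIntegral.integral_of_le hu.1, ← integral_Icc_eq_integral_Ioc]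
  have e : ∀ v, s.eval v * (Set.Iic u).indicator (fun _ => (1 : ℝ)) v
      = (Set.Iic u).indicator s.eval v := by
    intro v; simp [Set.indicator_apply]
  simp only [e]
  have hset : Set.Icc a b ∩ Set.Iic u = Set.Icc a u := by
    ext v
    exact ⟨fun h => ⟨h.1.1, h.2⟩, fun h => ⟨⟨h.1, h.2.trans hu.2⟩, h.2⟩⟩
  rw [setIntegral_indicator measurableSet_Iic, hset]

variable [IsProbabilityMeasure P]

theorem integral_integral (hab : a < b) (s : StepFn a b) (hX : IsSquareIntegrableOn P a b X d)
    (hd : ContDiffOn ℝ 1 d (Set.Icc a b)) :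
    ∫ ω, s.integral X ω ∂P
      = ∫ u in Set.Icc a b, s.eval u * derivWithin d (Set.Icc a b) u := by
  rw [s.integral_eval_mul ((hd.memLp_derivWithin_Icc hab 1).integrable le_rfl)]
  have hi : ∀ t ∈ Set.Icc a b, Integrable (X t) P :=
    fun t ht => (hX.memLp t ht).integrable (by norm_num)
  unfold integral
  rw [integral_finsetSum]
  · refine Finset.sum_congr rfl fun k _ => ?_
    rw [integral_const_mul, integral_sub (hi _ (s.r_mem k)) (hi _ (s.l_mem k)),
      hX.mean _ (s.r_mem k), hX.mean _ (s.l_mem k),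
      hd.integral_derivWithin_Icc hab (s.a_le k) (s.l_le_r k) (s.le_b k)]
  · exact fun k _ => ((hi _ (s.r_mem k)).sub (hi _ (s.l_mem k))).const_mul _

theorem covariance_integral_left (s : StepFn a b) (hX : ∀ t ∈ Set.Icc a b, MemLp (X t) 2 P)
    (hZ : MemLp Z 2 P) :
    cov[s.integral X, Z; P] = ∑ k, s.c k * (cov[X (s.r k), Z; P] - cov[X (s.l k), Z; P]) := by
  have hm : ∀ k, MemLp (fun ω => s.c k * (X (s.r k) ω - X (s.l k) ω)) 2 P :=
    fun k => ((hX _ (s.r_mem k)).sub (hX _ (s.l_mem k))).const_mul _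
  unfold integral
  rw [covariance_fun_sum_left hm hZ]
  refine Finset.sum_congr rfl fun k _ => ?_
  rw [covariance_const_mul_left,
    covariance_fun_sub_left (hX _ (s.r_mem k)) (hX _ (s.l_mem k)) hZ]

/-- The isometry for step functions. The covariance of X(u) with the elementary integral of `s'` is
c times the primitive of `s'` at u; differencing this over the intervals of `s` leaves integrals of
`s'` there, weighted by the values of `s`. -/
theorem covariance_integral_integral (s s' : StepFn a b)
    (hX : ∀ t ∈ Set.Icc a b, MemLp (X t) 2 P) (hX' : ∀ t ∈ Set.Icc a b, MemLp (X' t) 2 P)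
    (hc : HasMinCovariance P a b X X' c) :
    cov[s.integral X, s'.integral X'; P] = c * ∫ u in Set.Icc a b, s.eval u * s'.eval u := by
  have hs' : IntegrableOn s'.eval (Set.Icc a b) := s'.memLp_eval.integrable (by norm_num)
  have key : ∀ u ∈ Set.Icc a b, cov[X u, s'.integral X'; P] = c * ∫ v in a..u, s'.eval v := by
    intro u hu
    rw [covariance_comm, s'.covariance_integral_left hX' (hX u hu), s'.integral_eval_Iic hu,
      Finset.mul_sum]
    refine Finset.sum_congr rfl fun k _ => ?_
    rw [covariance_comm, hc u hu _ (s'.r_mem k), covariance_comm, hc u hu _ (s'.l_mem k)]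
    ring
  have hii : ∀ u ∈ Set.Icc a b, IntervalIntegrable s'.eval volume a u := fun u hu =>
    (intervalIntegrable_iff_integrableOn_Icc_of_le hu.1).2
      (hs'.mono_set (Set.Icc_subset_Icc_right hu.2))
  rw [s.covariance_integral_left hX (s'.memLp_integral hX'), s.integral_eval_mul hs',
    Finset.mul_sum]
  refine Finset.sum_congr rfl fun k _ => ?_
  rw [key _ (s.r_mem k), key _ (s.l_mem k), ← mul_sub,
    intervalIntegral.integral_interval_sub_left (hii _ (s.r_mem k)) (hii _ (s.l_mem k))]
  ring

/-- A variable whose covariance with X(t) is constant in t is uncorrelated with all increments. The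
case of interest is the initial value, since min(t, a) = a. -/
theorem covariance_integral_eq_zero (s : StepFn a b) (hX : ∀ t ∈ Set.Icc a b, MemLp (X t) 2 P)
    (hZ : MemLp Z 2 P) (hXZ : ∀ t ∈ Set.Icc a b, cov[X t, Z; P] = c) :
    cov[s.integral X, Z; P] = 0 := by
  rw [s.covariance_integral_left hX hZ]
  exact Finset.sum_eq_zero fun k _ => by
    rw [hXZ _ (s.r_mem k), hXZ _ (s.l_mem k), sub_self, mul_zero]

/-- The second moment is variance plus squared mean: the isometry handles the first, Cauchy–Schwarz
against the derivative of the drift the second. The bound makes the elementary integral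
L²-continuous. -/
theorem integral_sq_le (hab : a < b) (s : StepFn a b) (hX : IsSquareIntegrableOn P a b X d)
    (hd : ContDiffOn ℝ 1 d (Set.Icc a b)) (hc : HasMinCovariance P a b X X c) :
    ∫ ω, s.integral X ω ^ 2 ∂P
      ≤ (c + ∫ u in Set.Icc a b, derivWithin d (Set.Icc a b) u ^ 2)
        * ∫ u in Set.Icc a b, s.eval u ^ 2 := by
  have h1 := s.covariance_integral_integral s hX.memLp hX.memLp hc
  have h2 := s.memLp_integral hX.memLp
  rw [covariance_eq_sub h2 h2, s.integral_integral hab hX hd] at h1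
  have h3 := sq_integral_mul_le s.memLp_eval (hd.memLp_derivWithin_Icc hab 2)
  simp only [Pi.mul_apply, ← pow_two] at h1
  linarith

end StepFn

/-! ### The stochastic integral: existence, linearity, moments, uniqueness. -/

theorem tendsto_covariance_of_tendsto_eLpNorm [IsProbabilityMeasure P] {U V : ℕ → Ω → ℝ}
    {U' V' : Ω → ℝ}
    (hU : ∀ n, MemLp (U n) 2 P) (hU' : MemLp U' 2 P) (hV : ∀ n, MemLp (V n) 2 P)
    (hV' : MemLp V' 2 P)
    (hUU' : Tendsto (fun n => eLpNorm (fun x => U n x - U' x) 2 P) atTop (𝓝 0))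
    (hVV' : Tendsto (fun n => eLpNorm (fun x => V n x - V' x) 2 P) atTop (𝓝 0)) :
    Tendsto (fun n => cov[U n, V n; P]) atTop (𝓝 cov[U', V'; P]) := by
  have h1 : MemLp (fun _ : Ω => (1 : ℝ)) 2 P := memLp_const 1
  have m := tendsto_integral_mul_of_tendsto_eLpNorm hU hU' hV hV' hUU' hVV'
  have mU := tendsto_integral_mul_of_tendsto_eLpNorm hU hU' (fun _ => h1) h1 hUU'
    (tendsto_eLpNorm_self_sub _)
  have mV := tendsto_integral_mul_of_tendsto_eLpNorm hV hV' (fun _ => h1) h1 hVV'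
    (tendsto_eLpNorm_self_sub _)
  simp only [mul_one] at mU mV
  simp only [covariance_eq_sub (hU _) (hV _), covariance_eq_sub hU' hV', Pi.mul_apply]
  exact m.sub (mU.mul mV)

theorem exists_isStochInt [IsProbabilityMeasure P] (hab : a < b) {g : ℝ → ℝ}
    (hg : MemLp g 2 (volume.restrict (Set.Icc a b))) (hX : IsSquareIntegrableOn P a b X d)
    (hd : ContDiffOn ℝ 1 d (Set.Icc a b)) (hc : HasMinCovariance P a b X X c) :
    ∃ I, IsStochInt P a b g X I := by
  obtain ⟨s, hs⟩ := StepFn.exists_seq_tendsto hab hg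
  set K := c + ∫ u in Set.Icc a b, derivWithin d (Set.Icc a b) u ^ 2
  have hmX := fun n => (s n).memLp_integral hX.memLp
  let u : ℕ → Lp ℝ 2 (volume.restrict (Set.Icc a b)) := fun n => (s n).memLp_eval.toLp _
  let v : ℕ → Lp ℝ 2 P := fun n => (hmX n).toLp _
  have hu : Tendsto u atTop (𝓝 (hg.toLp g)) :=
    (Lp.tendsto_Lp_iff_tendsto_eLpNorm'' _ (fun n => (s n).memLp_eval) g hg).2 hs
  have hdist : ∀ n m, dist (v n) (v m) ≤ √K * dist (u n) (u m) := by
    intro n m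
    -- The difference of two step functions is again one, so the second moment bound is a Lipschitz
    -- estimate from L²([a, b]) to L²(P).
    have h := ((s n).add ((s m).smul (-1))).integral_sq_le hab hX hd hc
    simp only [StepFn.integral_add, StepFn.integral_smul, StepFn.eval_add, StepFn.eval_smul,
      neg_one_mul, ← sub_eq_add_neg] at h
    have e1 : dist (v n) (v m) ^ 2
        = ∫ ω, ((s n).integral X ω - (s m).integral X ω) ^ 2 ∂P := by
      rw [dist_eq_norm, ← MemLp.toLp_sub, norm_toLp_sq]
      rfl
    have e2 : dist (u n) (u m) ^ 2
        = ∫ t in Set.Icc a b, ((s n).eval t - (s m).eval t) ^ 2 := by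
      rw [dist_eq_norm, ← MemLp.toLp_sub, norm_toLp_sq]
      rfl
    rw [← e1, ← e2] at h
    calc dist (v n) (v m) = √(dist (v n) (v m) ^ 2) := (Real.sqrt_sq dist_nonneg).symm
      _ ≤ √(K * dist (u n) (u m) ^ 2) := Real.sqrt_le_sqrt h
      _ = √K * dist (u n) (u m) := by
        rw [Real.sqrt_mul' _ (sq_nonneg _), Real.sqrt_sq dist_nonneg]
  have hv : CauchySeq v := by
    rw [Metric.cauchySeq_iff']
    intro δ hδ
    -- The denominator is √K + 1 because √K may vanish.
    obtain ⟨N, hN⟩ := Metric.cauchySeq_iff'.1 hu.cauchySeq (δ / (√K + 1)) (by positivity)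
    refine ⟨N, fun n hn => ?_⟩
    have h1 := hN n hn
    rw [lt_div_iff₀ (by positivity)] at h1
    have h2 := hdist n N
    have h3 := dist_nonneg (x := u n) (y := u N)
    nlinarith
  obtain ⟨I, hI⟩ := cauchySeq_tendsto_of_complete hv
  refine ⟨I, Lp.memLp I, s, hs, ?_⟩
  refine (Lp.tendsto_Lp_iff_tendsto_eLpNorm'' _ hmX I (Lp.memLp I)).1 ?_
  rwa [Lp.toLp_coeFn]

namespace IsStochInt

variable {g f : ℝ → ℝ} {I J : Ω → ℝ}

theorem add (hI : IsStochInt P a b g X I) (hJ : IsStochInt P a b f X J)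
    (hg : MemLp g 2 (volume.restrict (Set.Icc a b)))
    (hf : MemLp f 2 (volume.restrict (Set.Icc a b))) (hX : ∀ t ∈ Set.Icc a b, MemLp (X t) 2 P) :
    IsStochInt P a b (fun t => g t + f t) X (fun ω => I ω + J ω) := by
  obtain ⟨hIm, s, hs, hsI⟩ := hI
  obtain ⟨hJm, r, hr, hrJ⟩ := hJ
  refine ⟨hIm.add hJm, fun n => (s n).add (r n), ?_, ?_⟩
  · refine tendsto_of_tendsto_of_tendsto_of_le_of_le tendsto_const_nhds
      (by simpa using hs.add hr) (fun _ => zero_le) fun n => ?_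
    have e : (fun t => ((s n).add (r n)).eval t - (g t + f t))
        = (fun t => (s n).eval t - g t) + fun t => (r n).eval t - f t := by
      ext t; simp only [StepFn.eval_add, Pi.add_apply]; ring
    simp only [e]
    exact eLpNorm_add_le ((s n).memLp_eval.sub hg).1 ((r n).memLp_eval.sub hf).1 (by norm_num)
  · refine tendsto_of_tendsto_of_tendsto_of_le_of_le tendsto_const_nhds
      (by simpa using hsI.add hrJ) (fun _ => zero_le) fun n => ?_
    have e : (fun ω => ((s n).add (r n)).integral X ω - (I ω + J ω))
        = (fun ω => (s n).integral X ω - I ω) + fun ω => (r n).integral X ω - J ω := by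
      ext t; simp only [StepFn.integral_add, Pi.add_apply]; ring
    simp only [e]
    exact eLpNorm_add_le (((s n).memLp_integral hX).sub hIm).1
      (((r n).memLp_integral hX).sub hJm).1 (by norm_num)

theorem const_mul (hI : IsStochInt P a b g X I) (x : ℝ) :
    IsStochInt P a b (fun t => x * g t) X (fun ω => x * I ω) := by
  obtain ⟨hIm, s, hs, hsI⟩ := hI
  refine ⟨hIm.const_mul x, fun n => (s n).smul x, ?_, ?_⟩
  · have e : ∀ n, (fun t => ((s n).smul x).eval t - x * g t)
        = x • fun t => (s n).eval t - g t := by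
      intro n; ext t; simp only [StepFn.eval_smul, Pi.smul_apply, smul_eq_mul]; ring
    simp only [e, eLpNorm_const_smul]
    simpa using ENNReal.Tendsto.const_mul hs (Or.inr enorm_ne_top)
  · have e : ∀ n, (fun ω => ((s n).smul x).integral X ω - x * I ω)
        = x • fun ω => (s n).integral X ω - I ω := by
      intro n; ext t; simp only [StepFn.integral_smul, Pi.smul_apply, smul_eq_mul]; ring
    simp only [e, eLpNorm_const_smul]
    simpa using ENNReal.Tendsto.const_mul hsI (Or.inr enorm_ne_top)

theorem zero : IsStochInt P a b (fun _ => 0) X (fun _ => 0) := by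
  refine ⟨MemLp.zero, fun _ => ⟨0, Fin.elim0, Fin.elim0, Fin.elim0, fun k => k.elim0,
    fun k => k.elim0, fun k => k.elim0⟩, ?_, ?_⟩ <;> simp [StepFn.eval, StepFn.integral]

theorem sum_const_mul {ι : Type*} (A : Finset ι) (x : ι → ℝ) {g : ι → ℝ → ℝ} {I : ι → Ω → ℝ}
    (hI : ∀ i, IsStochInt P a b (g i) X (I i))
    (hg : ∀ i, MemLp (g i) 2 (volume.restrict (Set.Icc a b)))
    (hX : ∀ t ∈ Set.Icc a b, MemLp (X t) 2 P) :
    IsStochInt P a b (fun t => ∑ i ∈ A, x i * g i t) X (fun ω => ∑ i ∈ A, x i * I i ω) := by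
  classical
  induction A using Finset.induction_on with
  | empty => simpa using zero
  | insert i A hi ih =>
    simp only [Finset.sum_insert hi]
    exact ((hI i).const_mul (x i)).add ih ((hg i).const_mul _)
      (memLp_finsetSum _ fun j _ => (hg j).const_mul _) hX

variable [IsProbabilityMeasure P]

theorem integral_eq (hab : a < b) (hI : IsStochInt P a b g X I)
    (hg : MemLp g 2 (volume.restrict (Set.Icc a b))) (hX : IsSquareIntegrableOn P a b X d)
    (hd : ContDiffOn ℝ 1 d (Set.Icc a b)) :
    ∫ ω, I ω ∂P = ∫ u in Set.Icc a b, g u * derivWithin d (Set.Icc a b) u := by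
  obtain ⟨hIm, s, hs, hsI⟩ := hI
  have h1 : MemLp (fun _ : Ω => (1 : ℝ)) 2 P := memLp_const 1
  have hD := hd.memLp_derivWithin_Icc hab 2
  have m1 := tendsto_integral_mul_of_tendsto_eLpNorm (fun n => (s n).memLp_integral hX.memLp) hIm
    (fun _ => h1) h1 hsI (tendsto_eLpNorm_self_sub _)
  have m2 := tendsto_integral_mul_of_tendsto_eLpNorm (fun n => (s n).memLp_eval) hg
    (fun _ => hD) hD hs (tendsto_eLpNorm_self_sub _)
  simp only [mul_one, (s _).integral_integral hab hX hd] at m1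
  exact tendsto_nhds_unique m1 m2

theorem covariance_eq (hI : IsStochInt P a b g X I) (hJ : IsStochInt P a b f X' J)
    (hg : MemLp g 2 (volume.restrict (Set.Icc a b)))
    (hf : MemLp f 2 (volume.restrict (Set.Icc a b)))
    (hX : ∀ t ∈ Set.Icc a b, MemLp (X t) 2 P) (hX' : ∀ t ∈ Set.Icc a b, MemLp (X' t) 2 P)
    (hc : HasMinCovariance P a b X X' c) :
    cov[I, J; P] = c * ∫ u in Set.Icc a b, g u * f u := by
  obtain ⟨hIm, s, hs, hsI⟩ := hI
  obtain ⟨hJm, r, hr, hrJ⟩ := hJ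
  have m1 := tendsto_covariance_of_tendsto_eLpNorm (fun n => (s n).memLp_integral hX) hIm
    (fun n => (r n).memLp_integral hX') hJm hsI hrJ
  have m2 := tendsto_integral_mul_of_tendsto_eLpNorm (fun n => (s n).memLp_eval) hg
    (fun n => (r n).memLp_eval) hf hs hr
  simp only [(s _).covariance_integral_integral (r _) hX hX' hc] at m1
  exact tendsto_nhds_unique m1 (m2.const_mul c)

theorem covariance_eq_zero (hI : IsStochInt P a b g X I)
    (hX : ∀ t ∈ Set.Icc a b, MemLp (X t) 2 P) (hZ : MemLp Z 2 P)
    (hXZ : ∀ t ∈ Set.Icc a b, cov[X t, Z; P] = c) :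
    cov[I, Z; P] = 0 := by
  obtain ⟨hIm, s, hs, hsI⟩ := hI
  have m1 := tendsto_covariance_of_tendsto_eLpNorm (fun n => (s n).memLp_integral hX) hIm
    (fun _ => hZ) hZ hsI (tendsto_eLpNorm_self_sub _)
  simp only [(s _).covariance_integral_eq_zero hX hZ hXZ] at m1
  exact (tendsto_nhds_unique m1 tendsto_const_nhds)

/-- The difference is a stochastic integral of the zero function, so its mean and variance both
vanish. This makes all later statements independent of the version picked by `stochInt`. -/
theorem ae_eq (hab : a < b) (hI : IsStochInt P a b g X I) (hJ : IsStochInt P a b g X J)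
    (hg : MemLp g 2 (volume.restrict (Set.Icc a b))) (hX : IsSquareIntegrableOn P a b X d)
    (hd : ContDiffOn ℝ 1 d (Set.Icc a b)) (hc : HasMinCovariance P a b X X c) :
    I =ᵐ[P] J := by
  have hK := hI.add (hJ.const_mul (-1)) hg (hg.const_mul _) hX.memLp
  have hk := hg.add (hg.const_mul (-1))
  have h1 := hK.covariance_eq hK hk hk hX.memLp hX.memLp hc
  have h2 := hK.integral_eq hab hk hX hd
  have h3 := hK.1.integrable_sq
  simp only [neg_one_mul, add_neg_cancel, zero_mul, integral_zero, mul_zero,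
    ← sub_eq_add_neg] at h1 h2 h3
  have hm : MemLp (fun ω => I ω - J ω) 2 P := hI.1.sub hJ.1
  rw [covariance_eq_sub hm hm] at h1
  simp only [Pi.mul_apply, h2, mul_zero, sub_zero] at h1
  simp only [← pow_two] at h1
  rw [integral_eq_zero_iff_of_nonneg (fun _ => sq_nonneg _) h3] at h1
  filter_upwards [h1] with ω hω
  exact sub_eq_zero.1 (pow_eq_zero_iff two_ne_zero |>.1 hω)

end IsStochInt

/-- Rules out the default value 0 in `stochInt`. -/
theorem isStochInt_stochInt [IsProbabilityMeasure P] (hab : a < b) {g : ℝ → ℝ}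
    (hg : MemLp g 2 (volume.restrict (Set.Icc a b))) (hX : IsSquareIntegrableOn P a b X d)
    (hd : ContDiffOn ℝ 1 d (Set.Icc a b)) (hc : HasMinCovariance P a b X X c) :
    IsStochInt P a b g X (stochInt P a b g X) := by
  have h := exists_isStochInt hab hg hX hd hc
  rw [stochInt, dif_pos h]
  exact h.choose_spec

end TwoGroup

namespace TwoGroup

/-! ### Integrals of matrix-valued functions. -/

section MatrixIntegral

variable {l m n : Type*} {a b : ℝ}

theorem matInt_apply_eq_setIntegral (hab : a ≤ b) (A : ℝ → Matrix m n ℝ) (i : m) (j : n) :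
    matInt a b A i j = ∫ t in Set.Icc a b, A t i j := by
  rw [matInt, Matrix.of_apply, intervalIntegral.integral_of_le hab, integral_Icc_eq_integral_Ioc]

theorem matInt_mul_const [Fintype n] (hab : a ≤ b) {A : ℝ → Matrix m n ℝ} (N : Matrix n l ℝ)
    (hA : ∀ i j, IntegrableOn (fun t => A t i j) (Set.Icc a b)) :
    matInt a b (fun t => A t * N) = matInt a b A * N := by
  ext i j
  simp only [matInt_apply_eq_setIntegral hab, Matrix.mul_apply]
  rw [integral_finsetSum _ fun k _ => (hA i k).mul_const _]
  simp only [integral_mul_const]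

theorem matInt_const_mul [Fintype m] (hab : a ≤ b) {A : ℝ → Matrix m n ℝ} (N : Matrix l m ℝ)
    (hA : ∀ i j, IntegrableOn (fun t => A t i j) (Set.Icc a b)) :
    matInt a b (fun t => N * A t) = N * matInt a b A := by
  ext i j
  simp only [matInt_apply_eq_setIntegral hab, Matrix.mul_apply]
  rw [integral_finsetSum _ fun k _ => (hA k j).const_mul _]
  simp only [integral_const_mul]

theorem matInt_transpose (A : ℝ → Matrix m n ℝ) :
    matInt a b (fun t => (A t)ᵀ) = (matInt a b A)ᵀ := rfl

/-- All entries of the matrix function `A` are square integrable on `[a, b]`. -/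
def IsL2 (a b : ℝ) (A : ℝ → Matrix m n ℝ) : Prop :=
  ∀ i j, MemLp (fun t => A t i j) 2 (volume.restrict (Set.Icc a b))

theorem IsL2.const_mul [Fintype m] {A : ℝ → Matrix m n ℝ} (hA : IsL2 a b A) (N : Matrix l m ℝ) :
    IsL2 a b fun t => N * A t := fun i j => by
  simp only [Matrix.mul_apply]
  exact memLp_finsetSum _ fun k _ => (hA k j).const_mul _

theorem IsL2.mul_const [Fintype n] {A : ℝ → Matrix m n ℝ} (hA : IsL2 a b A) (N : Matrix n l ℝ) :
    IsL2 a b fun t => A t * N := fun i j => by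
  simp only [Matrix.mul_apply]
  exact memLp_finsetSum _ fun k _ => (hA i k).mul_const _

theorem IsL2.integrableOn_mul_transpose [Fintype n] {A : ℝ → Matrix m n ℝ} {B : ℝ → Matrix l n ℝ}
    (hA : IsL2 a b A) (hB : IsL2 a b B) (i : m) (j : l) :
    IntegrableOn (fun t => (A t * (B t)ᵀ) i j) (Set.Icc a b) := by
  simp only [Matrix.mul_apply, Matrix.transpose_apply]
  exact integrable_finsetSum _ fun k _ => (hA i k).integrable_mul (hB j k)

theorem IsC1.isL2_matDeriv (hab : a < b) {F : ℝ → Matrix m n ℝ} (hF : IsC1 a b F) :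
    IsL2 a b (matDeriv a b F) :=
  fun i j => (hF i j).memLp_derivWithin_Icc hab 2

end MatrixIntegral

/-! ### Means and covariances of linear functionals. -/

section LinearFunctionals

variable {Ω : Type*} [MeasurableSpace Ω] {P : Measure Ω} {a b : ℝ} {p q : ℕ}
  {X : ℝ → Ω → Fin 2 → ℝ} {D : ℝ → Fin 2 → ℝ} {S : Matrix (Fin 2) (Fin 2) ℝ}

/-- `X` has on `[a, b]` the first two moments of the `C¹` drift `D` plus a Brownian motion with
covariance matrix `S`. -/
structure HasBrownianMoments (P : Measure Ω) (a b : ℝ) (X : ℝ → Ω → Fin 2 → ℝ)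
    (D : ℝ → Fin 2 → ℝ) (S : Matrix (Fin 2) (Fin 2) ℝ) : Prop where
  sq : ∀ k, IsSquareIntegrableOn P a b (fun t ω => X t ω k) (fun t => D t k)
  smooth : ∀ k, ContDiffOn ℝ 1 (fun t => D t k) (Set.Icc a b)
  cov : ∀ k l, HasMinCovariance P a b (fun t ω => X t ω k) (fun t ω => X t ω l) (S k l)

/-- The linear functional `∫_a^b G dX + H X(a)`. -/
noncomputable def linFun (P : Measure Ω) (a b : ℝ) (G : ℝ → Matrix (Fin p) (Fin 2) ℝ)
    (H : Matrix (Fin p) (Fin 2) ℝ) (X : ℝ → Ω → Fin 2 → ℝ) (ω : Ω) : Fin p → ℝ :=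
  matStochInt P a b G X ω + H *ᵥ X a ω

theorem linFun_apply (G : ℝ → Matrix (Fin p) (Fin 2) ℝ) (H : Matrix (Fin p) (Fin 2) ℝ) (ω : Ω)
    (i : Fin p) :
    linFun P a b G H X ω i
      = ∑ k, (stochInt P a b (fun t => G t i k) (fun t ω' => X t ω' k) ω + H i k * X a ω k) := by
  rw [Finset.sum_add_distrib]
  rfl

namespace HasBrownianMoments

theorem memLp_initial (hX : HasBrownianMoments P a b X D S) (hab : a < b) (k : Fin 2) :
    MemLp (fun ω => X a ω k) 2 P :=
  (hX.sq k).memLp a (Set.left_mem_Icc.2 hab.le)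

variable [IsProbabilityMeasure P] (hX : HasBrownianMoments P a b X D S) (hab : a < b)
  {G : ℝ → Matrix (Fin p) (Fin 2) ℝ} {G' : ℝ → Matrix (Fin q) (Fin 2) ℝ}
  {H : Matrix (Fin p) (Fin 2) ℝ} {H' : Matrix (Fin q) (Fin 2) ℝ}

include hX hab

theorem isStochInt (hG : IsL2 a b G) (i : Fin p) (k : Fin 2) :
    IsStochInt P a b (fun t => G t i k) (fun t ω => X t ω k)
      (stochInt P a b (fun t => G t i k) (fun t ω => X t ω k)) :=
  isStochInt_stochInt hab (hG i k) (hX.sq k) (hX.smooth k) (hX.cov k k)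

theorem memLp_summand (hG : IsL2 a b G) (i : Fin p) (k : Fin 2) :
    MemLp (fun ω => stochInt P a b (fun t => G t i k) (fun t ω' => X t ω' k) ω
      + H i k * X a ω k) 2 P :=
  (hX.isStochInt hab hG i k).1.add ((hX.memLp_initial hab k).const_mul _)

theorem memLp_linFun (hG : IsL2 a b G) (i : Fin p) :
    MemLp (fun ω => linFun P a b G H X ω i) 2 P := by
  simp only [linFun_apply]
  exact memLp_finsetSum _ fun k _ => hX.memLp_summand hab hG i k

theorem integral_linFun (hG : IsL2 a b G) (i : Fin p) :
    ∫ ω, linFun P a b G H X ω i ∂P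
      = ∑ k, ((∫ t in Set.Icc a b, G t i k * derivWithin (fun s => D s k) (Set.Icc a b) t)
        + H i k * D a k) := by
  simp only [linFun_apply]
  rw [integral_finsetSum _ fun k _ => (hX.memLp_summand hab hG i k).integrable (by norm_num)]
  refine Finset.sum_congr rfl fun k _ => ?_
  rw [integral_add ((hX.isStochInt hab hG i k).1.integrable (by norm_num))
    (((hX.memLp_initial hab k).integrable (by norm_num)).const_mul _), integral_const_mul,
    (hX.sq k).mean a (Set.left_mem_Icc.2 hab.le),
    (hX.isStochInt hab hG i k).integral_eq hab (hG i k) (hX.sq k) (hX.smooth k)]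

/-- Expanding bilinearly leaves the isometry term and the initial term, whose factor a is min(a, a);
the cross terms vanish because the initial value is uncorrelated with later increments. -/
theorem covariance_linFun (hG : IsL2 a b G) (hG' : IsL2 a b G') (i : Fin p) (j : Fin q) :
    cov[fun ω => linFun P a b G H X ω i, fun ω => linFun P a b G' H' X ω j; P]
      = (matInt a b (fun t => G t * S * (G' t)ᵀ) + a • (H * S * H'ᵀ)) i j := by
  have ha : a ∈ Set.Icc a b := Set.left_mem_Icc.2 hab.le
  have hI := fun k => hX.isStochInt hab hG i k
  have hJ := fun k => hX.isStochInt hab hG' j k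
  have hXa := hX.memLp_initial hab
  simp only [linFun_apply]
  rw [covariance_fun_sum_fun_sum (hX.memLp_summand hab hG i) (hX.memLp_summand hab hG' j)]
  have key : ∀ k l, cov[fun ω => stochInt P a b (fun t => G t i k) (fun t ω' => X t ω' k) ω
        + H i k * X a ω k, fun ω => stochInt P a b (fun t => G' t j l) (fun t ω' => X t ω' l) ω
        + H' j l * X a ω l; P]
      = S k l * (∫ t in Set.Icc a b, G t i k * G' t j l) + a * (H i k * S k l * H' j l) := by
    intro k l
    have h0 : ∀ k l, ∀ t ∈ Set.Icc a b, cov[fun ω => X t ω k, fun ω => X a ω l; P]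
        = S k l * a := by
      intro k l t ht
      rw [← min_eq_right ht.1, ← hX.cov k l t ht a ha]
      simp only [min_eq_right ht.1]
    have hk : MemLp (fun ω => H i k * X a ω k) 2 P := (hXa k).const_mul _
    have hl : MemLp (fun ω => H' j l * X a ω l) 2 P := (hXa l).const_mul _
    have e1 := (hI k).covariance_eq (hJ l) (hG i k) (hG' j l) (hX.sq k).memLp (hX.sq l).memLp
      (hX.cov k l)
    have e2 := (hI k).covariance_eq_zero (hX.sq k).memLp (hXa l) (h0 k l)
    have e3 := (hJ l).covariance_eq_zero (hX.sq l).memLp (hXa k) (h0 l k)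
    refine (covariance_add_left (hI k).1 hk ((hJ l).1.add hl)).trans ?_
    refine (congrArg₂ (· + ·) (covariance_add_right (hI k).1 (hJ l).1 hl)
      (covariance_add_right hk (hJ l).1 hl)).trans ?_
    simp only [covariance_const_mul_left, covariance_const_mul_right]
    rw [e1, e2, covariance_comm, e3, h0 k l a ha]
    ring
  simp only [key]
  rw [Matrix.add_apply, matInt_apply_eq_setIntegral hab.le]
  have hint : ∫ t in Set.Icc a b, (G t * S * (G' t)ᵀ) i j
      = ∑ k, ∑ l, S k l * ∫ t in Set.Icc a b, G t i k * G' t j l := by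
    have e : ∀ t, (G t * S * (G' t)ᵀ) i j = ∑ k, ∑ l, S k l * (G t i k * G' t j l) := by
      intro t
      simp only [Matrix.mul_apply, Matrix.transpose_apply, Finset.sum_mul]
      rw [Finset.sum_comm]
      exact Finset.sum_congr rfl fun k _ => Finset.sum_congr rfl fun l _ => by ring
    have hi : ∀ k l, IntegrableOn (fun t => S k l * (G t i k * G' t j l)) (Set.Icc a b) :=
      fun k l => ((hG i k).integrable_mul (hG' j l)).const_mul _
    simp only [e]
    rw [integral_finsetSum _ fun k _ => integrable_finsetSum _ fun l _ => hi k l]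
    refine Finset.sum_congr rfl fun k _ => ?_
    rw [integral_finsetSum _ fun l _ => hi k l]
    simp only [integral_const_mul]
  rw [hint, Matrix.smul_apply, smul_eq_mul]
  simp only [Finset.sum_add_distrib, ← Finset.mul_sum, Matrix.mul_apply, Matrix.transpose_apply,
    Finset.sum_mul]
  congr 2
  exact Finset.sum_comm

/-- Versions of the integrals are chosen separately for each integrand, so linearity holds only
almost surely, through uniqueness. -/
theorem mulVec_linFun_ae_eq (hG : IsL2 a b G) (N : Matrix (Fin q) (Fin p) ℝ) :
    (fun ω => N *ᵥ linFun P a b G H X ω)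
      =ᵐ[P] linFun P a b (fun t => N * G t) (N * H) X := by
  have hNG := hG.const_mul N
  have key : ∀ i k, (fun ω => ∑ j, N i j *
      stochInt P a b (fun t => G t j k) (fun t ω' => X t ω' k) ω)
        =ᵐ[P] stochInt P a b (fun t => (N * G t) i k) (fun t ω' => X t ω' k) := by
    intro i k
    have h := IsStochInt.sum_const_mul Finset.univ (N i) (fun j => hX.isStochInt hab hG j k)
      (fun j => hG j k) (hX.sq k).memLp
    exact h.ae_eq hab (hX.isStochInt hab hNG i k) (hNG i k) (hX.sq k) (hX.smooth k) (hX.cov k k)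
  have key' : ∀ᵐ ω ∂P, ∀ i k, _ := ae_all_iff.2 fun i => ae_all_iff.2 fun k => key i k
  filter_upwards [key'] with ω hω
  ext i
  simp only [linFun_apply, ← hω]
  simp only [Matrix.mulVec, linFun_apply, dotProduct, Finset.mul_sum, mul_add,
    Matrix.mul_apply, Finset.sum_mul, ← mul_assoc]
  rw [Finset.sum_comm]
  exact Finset.sum_congr rfl fun k _ => Finset.sum_add_distrib

end HasBrownianMoments

end LinearFunctionals

end TwoGroup

namespace TwoGroup

/-! ### The matrix Σ, its root, and the moments of the observed process. -/

section Covariance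

theorem posSemidef_and_isUnit_det_Sig {σ₁ σ₂ ρ : ℝ} (h₁ : 0 < σ₁) (h₂ : 0 < σ₂)
    (hρ : ρ ∈ Set.Ioo (-1 : ℝ) 1) :
    (Sig σ₁ σ₂ ρ).PosSemidef ∧ IsUnit (Sig σ₁ σ₂ ρ).det := by
  have hρ2 : 0 < 1 - ρ ^ 2 := by nlinarith [hρ.1, hρ.2]
  constructor
  · refine Matrix.PosSemidef.of_dotProduct_mulVec_nonneg ?_ fun x => ?_
    · ext i j
      fin_cases i <;> fin_cases j <;> simp [Sig]
    -- Completing the square in the first coordinate.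
    · have e : star x ⬝ᵥ Sig σ₁ σ₂ ρ *ᵥ x
          = (σ₁ * x 0 + ρ * (σ₂ * x 1)) ^ 2 + (1 - ρ ^ 2) * (σ₂ * x 1) ^ 2 := by
        simp [Sig, Matrix.mulVec, dotProduct, Fin.sum_univ_two]
        ring
      rw [e]
      positivity
  · have e : (Sig σ₁ σ₂ ρ).det = σ₁ ^ 2 * σ₂ ^ 2 * (1 - ρ ^ 2) := by
      simp [Sig, Matrix.det_fin_two]
      ring
    rw [e, isUnit_iff_ne_zero]
    positivity

theorem sqrtSig_mul_transpose {σ₁ σ₂ ρ : ℝ} (h : (Sig σ₁ σ₂ ρ).PosSemidef) :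
    sqrtSig σ₁ σ₂ ρ * (sqrtSig σ₁ σ₂ ρ)ᵀ = Sig σ₁ σ₂ ρ := by
  have hn : (sqrtSig σ₁ σ₂ ρ).PosSemidef := Matrix.nonneg_iff_posSemidef.1 (CFC.sqrt_nonneg _)
  have ht : (sqrtSig σ₁ σ₂ ρ)ᵀ = sqrtSig σ₁ σ₂ ρ := hn.isHermitian
  rw [ht]
  exact CFC.sqrt_mul_sqrt_self _ (Matrix.nonneg_iff_posSemidef.2 h)

end Covariance

variable {Ω : Type*} [MeasurableSpace Ω] {P : Measure Ω} {ε : Fin 2 → ℝ≥0 → Ω → ℝ}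
  {a b : ℝ} {p : ℕ} {F : ℝ → Matrix (Fin p) (Fin 2) ℝ}

namespace IsBrownianPair

theorem memLp (hε : IsBrownianPair ε P) (k : Fin 2) (t : ℝ≥0) : MemLp (ε k t) 2 P :=
  ((hε.1 k).hasLaw_eval t).hasGaussianLaw.memLp_two

theorem covariance_eq (hε : IsBrownianPair ε P) (k l : Fin 2) (s t : ℝ≥0) :
    cov[ε k s, ε l t; P] = if k = l then (min s t : ℝ) else 0 := by
  split_ifs with h
  · subst h
    rw [(hε.1 k).covariance_eval, NNReal.coe_min]
  · exact ((hε.2.indepFun h).comp (measurable_pi_apply s) (measurable_pi_apply t)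
      ).covariance_eq_zero (hε.memLp k s) (hε.memLp l t)

theorem hasBrownianMoments [IsProbabilityMeasure P] (hε : IsBrownianPair ε P) (ha : 0 < a)
    (hF : IsC1 a b F) (R : Matrix (Fin 2) (Fin 2) ℝ) (θ : Fin p → ℝ) :
    HasBrownianMoments P a b (obs F R ε θ) (fun t => (F t)ᵀ *ᵥ θ) (R * Rᵀ) := by
  have hm : ∀ k m t, MemLp (fun ω => R k m * ε m t ω) 2 P :=
    fun k m t => (hε.memLp m t).const_mul _
  have hs : ∀ k t, MemLp (fun ω => ∑ m, R k m * ε m t ω) 2 P :=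
    fun k t => memLp_finsetSum _ fun m _ => hm k m t
  have he : ∀ t ω k, obs F R ε θ t ω k
      = ((F t)ᵀ *ᵥ θ) k + ∑ m, R k m * ε m t.toNNReal ω := fun _ _ _ => rfl
  refine ⟨fun k => ⟨fun t _ => ?_, fun t _ => ?_⟩, fun k => ?_, fun k l s hst t htt => ?_⟩
  · simp only [he]
    exact (memLp_const (((F t)ᵀ *ᵥ θ) k)).add (hs k t.toNNReal)
  · simp only [he]
    refine (integral_add (integrable_const _) ((hs k t.toNNReal).integrable (by norm_num))).trans ?_
    rw [integral_finsetSum _ fun m _ => (hm k m t.toNNReal).integrable (by norm_num)]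
    simp only [integral_const_mul, (hε.1 _).integral_eval, mul_zero, Finset.sum_const_zero]
    simp
  · simp only [Matrix.mulVec, dotProduct, Matrix.transpose_apply]
    exact ContDiffOn.sum fun m _ => (hF m k).mul contDiffOn_const
  · simp only [he]
    refine (covariance_const_add_left ((hs k s.toNNReal).integrable (by norm_num)) _).trans ?_
    refine (covariance_const_add_right ((hs l t.toNNReal).integrable (by norm_num)) _).trans ?_
    rw [covariance_fun_sum_fun_sum (fun m => hm k m _) (fun m => hm l m _)]
    simp only [covariance_const_mul_left, covariance_const_mul_right]
    have hc := fun m n => hε.covariance_eq m n s.toNNReal t.toNNReal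
    -- All times in [a, b] are nonnegative since a > 0, so the truncation in `toNNReal` changes
    -- nothing.
    rw [Real.coe_toNNReal _ (ha.le.trans hst.1), Real.coe_toNNReal _ (ha.le.trans htt.1)] at hc
    simp only [Fin.sum_univ_two, hc, Matrix.mul_apply, Matrix.transpose_apply]
    simp
    ring

end IsBrownianPair

/-! ### Unbiasedness and mean squared error matrices. -/

section Mean

/-- The matrix `∫_a^b G Ḟᵀ ds + H F(a)ᵀ` that maps `θ` to the mean of `∫_a^b G dY + H Y(a)`. -/
noncomputable def meanMatrix {q : ℕ} (a b : ℝ) (F : ℝ → Matrix (Fin p) (Fin 2) ℝ)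
    (G : ℝ → Matrix (Fin q) (Fin 2) ℝ) (H : Matrix (Fin q) (Fin 2) ℝ) :
    Matrix (Fin q) (Fin p) ℝ :=
  matInt a b (fun t => G t * (matDeriv a b F t)ᵀ) + H * (F a)ᵀ

variable {q : ℕ} {G : ℝ → Matrix (Fin q) (Fin 2) ℝ} {H : Matrix (Fin q) (Fin 2) ℝ}

theorem derivWithin_transpose_mulVec (hF : IsC1 a b F) (θ : Fin p → ℝ) (k : Fin 2)
    {t : ℝ} (ht : t ∈ Set.Icc a b) :
    derivWithin (fun s => ((F s)ᵀ *ᵥ θ) k) (Set.Icc a b) t = ((matDeriv a b F t)ᵀ *ᵥ θ) k := by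
  simp only [Matrix.mulVec, dotProduct, Matrix.transpose_apply, matDeriv, Matrix.of_apply]
  have hd : ∀ m, DifferentiableWithinAt ℝ (fun s => F s m k) (Set.Icc a b) t :=
    fun m => (hF m k).differentiableOn one_ne_zero t ht
  rw [derivWithin_fun_sum fun m _ => (hd m).mul_const _]
  exact Finset.sum_congr rfl fun m _ => derivWithin_mul_const (hd m) _

theorem integral_linFun_obs [IsProbabilityMeasure P] (hε : IsBrownianPair ε P) (ha : 0 < a)
    (hab : a < b) (hF : IsC1 a b F) (R : Matrix (Fin 2) (Fin 2) ℝ) (θ : Fin p → ℝ)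
    (hG : IsL2 a b G) (i : Fin q) :
    ∫ ω, linFun P a b G H (obs F R ε θ) ω i ∂P = (meanMatrix a b F G H *ᵥ θ) i := by
  have hF' := hF.isL2_matDeriv hab
  rw [(hε.hasBrownianMoments ha hF R θ).integral_linFun hab hG]
  have e : ∀ k, ∫ t in Set.Icc a b,
      G t i k * derivWithin (fun s => ((F s)ᵀ *ᵥ θ) k) (Set.Icc a b) t
        = ∑ m, (∫ t in Set.Icc a b, G t i k * matDeriv a b F t m k) * θ m := by
    intro k
    rw [setIntegral_congr_fun measurableSet_Icc fun t ht => by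
      rw [derivWithin_transpose_mulVec hF θ k ht]]
    simp only [Matrix.mulVec, dotProduct, Matrix.transpose_apply, Finset.mul_sum, ← mul_assoc]
    have hi : ∀ m, IntegrableOn (fun t => G t i k * matDeriv a b F t m k * θ m) (Set.Icc a b) :=
      fun m => ((hG i k).integrable_mul (hF' m k)).mul_const _
    rw [integral_finsetSum _ fun m _ => hi m]
    simp only [integral_mul_const]
  have e' : ∀ m, ∫ t in Set.Icc a b, ∑ k, G t i k * matDeriv a b F t m k
      = ∑ k, ∫ t in Set.Icc a b, G t i k * matDeriv a b F t m k :=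
    fun m => integral_finsetSum _ fun k _ => (hG i k).integrable_mul (hF' m k)
  simp only [e]
  simp only [meanMatrix, Matrix.mulVec, dotProduct, Matrix.add_apply,
    matInt_apply_eq_setIntegral hab.le, Matrix.mul_apply, Matrix.transpose_apply, e',
    Finset.sum_add_distrib, add_mul, Finset.sum_mul, Finset.mul_sum, mul_assoc]
  exact congrArg₂ (· + ·) Finset.sum_comm Finset.sum_comm

/-- The mean is linear in θ, and a matrix fixing every θ is the identity. -/
theorem isUnbiased_linFun_iff [IsProbabilityMeasure P] (hε : IsBrownianPair ε P) (ha : 0 < a)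
    (hab : a < b) (hF : IsC1 a b F) (R : Matrix (Fin 2) (Fin 2) ℝ)
    {G : ℝ → Matrix (Fin p) (Fin 2) ℝ} {H : Matrix (Fin p) (Fin 2) ℝ} (hG : IsL2 a b G) :
    IsUnbiased P (fun θ => linFun P a b G H (obs F R ε θ)) ↔ meanMatrix a b F G H = 1 := by
  refine ⟨fun h => Matrix.mulVec_injective (funext fun θ => funext fun i => ?_), fun h θ i => ?_⟩
  · rw [← integral_linFun_obs hε ha hab hF R θ hG, (h θ i).2, Matrix.one_mulVec]
  · refine ⟨((hε.hasBrownianMoments ha hF R θ).memLp_linFun hab hG i).integrable (by norm_num), ?_⟩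
    rw [integral_linFun_obs hε ha hab hF R θ hG, h, Matrix.one_mulVec]

theorem IsUnbiased.congr {T T' : (Fin p → ℝ) → Ω → Fin p → ℝ} (h : ∀ θ, T θ =ᵐ[P] T' θ)
    (hT : IsUnbiased P T) : IsUnbiased P T' := by
  intro θ i
  have e : (fun ω => T θ ω i) =ᵐ[P] fun ω => T' θ ω i := by
    filter_upwards [h θ] with ω hω
    rw [hω]
  exact ⟨(hT θ i).1.congr e, (integral_congr_ae e).symm.trans (hT θ i).2⟩

theorem mse_congr {U U' V V' : Ω → Fin p → ℝ} (hU : U =ᵐ[P] U') (hV : V =ᵐ[P] V') :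
    mse P U V = mse P U' V' := by
  ext i j
  refine integral_congr_ae ?_
  filter_upwards [hU, hV] with ω h1 h2
  rw [h1, h2]

theorem mse_apply_eq_covariance [IsProbabilityMeasure P] {U V : Ω → Fin p → ℝ}
    (hUV : ∀ i, ∫ ω, (U ω i - V ω i) ∂P = 0) (hU : ∀ i, MemLp (fun ω => U ω i) 2 P)
    (hV : ∀ i, MemLp (fun ω => V ω i) 2 P) (i j : Fin p) :
    mse P U V i j = cov[fun ω => U ω i - V ω i, fun ω => U ω j - V ω j; P] := by
  have hm : ∀ i, MemLp (fun ω => U ω i - V ω i) 2 P := fun i => (hU i).sub (hV i)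
  rw [covariance_eq_sub (hm i) (hm j), hUV i, zero_mul, sub_zero]
  rfl

/-- The quadratic form at x is the second moment of the scalar variable xᵀ(U - V). -/
theorem posSemidef_mse {U V : Ω → Fin p → ℝ} (hU : ∀ i, MemLp (fun ω => U ω i) 2 P)
    (hV : ∀ i, MemLp (fun ω => V ω i) 2 P) : (mse P U V).PosSemidef := by
  refine Matrix.PosSemidef.of_dotProduct_mulVec_nonneg ?_ fun x => ?_
  · ext i j
    simp [mse, mul_comm]
  · have hm : ∀ i, MemLp (fun ω => U ω i - V ω i) 2 P := fun i => (hU i).sub (hV i)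
    have hi : ∀ i j, Integrable (fun ω => x i * ((U ω i - V ω i) * (U ω j - V ω j) * x j)) P :=
      fun i j => (((hm i).integrable_mul (hm j)).mul_const _).const_mul _
    have e : star x ⬝ᵥ mse P U V *ᵥ x = ∫ ω, (∑ i, x i * (U ω i - V ω i)) ^ 2 ∂P := by
      have e1 : ∀ ω, (∑ i, x i * (U ω i - V ω i)) ^ 2
          = ∑ i, ∑ j, x i * ((U ω i - V ω i) * (U ω j - V ω j) * x j) := by
        intro ω
        rw [pow_two, Finset.sum_mul_sum]
        exact Finset.sum_congr rfl fun i _ => Finset.sum_congr rfl fun j _ => by ring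
      simp only [e1]
      rw [integral_finsetSum _ fun i _ => integrable_finsetSum _ fun j _ => hi i j]
      simp only [star_trivial, dotProduct, Matrix.mulVec, mse, Matrix.of_apply, Finset.mul_sum]
      refine Finset.sum_congr rfl fun i _ => ?_
      rw [integral_finsetSum _ fun j _ => hi i j]
      simp only [integral_const_mul, integral_mul_const]
    rw [e]
    exact integral_nonneg fun _ => sq_nonneg _

end Mean

end TwoGroup

namespace TwoGroup

variable {Ω : Type*} [MeasurableSpace Ω] {P : Measure Ω}
  {ε : Fin 2 → ℝ≥0 → Ω → ℝ} {a b : ℝ} {p : ℕ} {F : ℝ → Matrix (Fin p) (Fin 2) ℝ}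
  {R S : Matrix (Fin 2) (Fin 2) ℝ}

/-! ### The discrete estimator. -/

section Discrete

theorem matInt_matDeriv_transpose (hab : a < b) (hF : IsC1 a b F) {l r : ℝ} (hl : a ≤ l)
    (hlr : l ≤ r) (hr : r ≤ b) :
    matInt l r (fun s => (matDeriv a b F s)ᵀ) = (F r - F l)ᵀ := by
  ext i j
  exact (hF j i).integral_derivWithin_Icc hab hl hlr hr

theorem integrable_mulVec {q : ℕ} {m : Type*} [Fintype m] (N : Matrix (Fin q) m ℝ)
    {U : Ω → m → ℝ} (hU : ∀ k, Integrable (fun ω => U ω k) P) (i : Fin q) :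
    Integrable (fun ω => (N *ᵥ U ω) i) P :=
  integrable_finsetSum _ fun k _ => (hU k).const_mul _

theorem integral_mulVec {q : ℕ} {m : Type*} [Fintype m] (N : Matrix (Fin q) m ℝ)
    {U : Ω → m → ℝ} (hU : ∀ k, Integrable (fun ω => U ω k) P) (i : Fin q) :
    ∫ ω, (N *ᵥ U ω) i ∂P = (N *ᵥ fun k => ∫ ω, U ω k ∂P) i := by
  simp only [Matrix.mulVec, dotProduct]
  rw [integral_finsetSum _ fun k _ => (hU k).const_mul _]
  simp only [integral_const_mul]

theorem integral_discreteEst [IsProbabilityMeasure P] (hε : IsBrownianPair ε P)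
    (ha : 0 < a) (hab : a < b)
    (hF : IsC1 a b F) (n : ℕ) {t : ℕ → ℝ} (Φ : ℕ → Matrix (Fin p) (Fin 2) ℝ)
    (ht : ∀ i ∈ Finset.Icc 2 n, t i ∈ Set.Icc a b ∧ t (i - 1) ∈ Set.Icc a b) (θ : Fin p → ℝ)
    (i : Fin p) :
    Integrable (fun ω => discreteEst a b F S n t Φ (obs F R ε θ) ω i) P ∧
      ∫ ω, discreteEst a b F S n t Φ (obs F R ε θ) ω i ∂P
        = (((infoM a b F S)⁻¹ * (∑ i ∈ Finset.Icc 2 n, Φ i * S⁻¹ * (F (t i) - F (t (i - 1)))ᵀ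
          + (1 / a) • (F a * S⁻¹ * (F a)ᵀ))) *ᵥ θ) i := by
  have hX := hε.hasBrownianMoments ha hF R θ
  have haI : a ∈ Set.Icc a b := Set.left_mem_Icc.2 hab.le
  have hY : ∀ u ∈ Set.Icc a b, ∀ k, Integrable (fun ω => obs F R ε θ u ω k) P :=
    fun u hu k => ((hX.sq k).memLp u hu).integrable (by norm_num)
  have hd : ∀ i ∈ Finset.Icc 2 n, ∀ k,
      Integrable (fun ω => (obs F R ε θ (t i) ω - obs F R ε θ (t (i - 1)) ω) k) P :=
    fun i hi k => (hY _ (ht i hi).1 k).sub (hY _ (ht i hi).2 k)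
  have hterm : ∀ i ∈ Finset.Icc 2 n, ∀ k, Integrable (fun ω =>
      ((Φ i * S⁻¹) *ᵥ (obs F R ε θ (t i) ω - obs F R ε θ (t (i - 1)) ω)) k) P :=
    fun i hi k => integrable_mulVec _ (hd i hi) k
  have hinit := integrable_mulVec ((1 / a) • (F a * S⁻¹)) (hY a haI)
  have hsum : ∀ k, Integrable (fun ω => (∑ i ∈ Finset.Icc 2 n,
      (Φ i * S⁻¹) *ᵥ (obs F R ε θ (t i) ω - obs F R ε θ (t (i - 1)) ω)) k) P := by
    intro k
    simp only [Finset.sum_apply]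
    exact integrable_finsetSum _ fun i hi => hterm i hi k
  have hall : ∀ k, Integrable (fun ω => (∑ i ∈ Finset.Icc 2 n,
      (Φ i * S⁻¹) *ᵥ (obs F R ε θ (t i) ω - obs F R ε θ (t (i - 1)) ω)
      + ((1 / a) • (F a * S⁻¹)) *ᵥ obs F R ε θ a ω) k) P :=
    fun k => (hsum k).add (hinit k)
  refine ⟨integrable_mulVec _ hall i, (integral_mulVec _ hall i).trans ?_⟩
  rw [← Matrix.mulVec_mulVec]
  refine congrFun (congrArg _ (funext fun k => ?_)) _
  refine (integral_add (hsum k) (hinit k)).trans ?_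
  rw [integral_mulVec _ (hY a haI)]
  simp only [Finset.sum_apply, (hX.sq _).mean a haI]
  rw [integral_finsetSum _ fun i hi => hterm i hi k, Matrix.add_mulVec, Pi.add_apply,
    Matrix.sum_mulVec, Finset.sum_apply]
  congr 1
  · refine Finset.sum_congr rfl fun i hi => ?_
    rw [integral_mulVec _ (hd i hi), ← Matrix.mulVec_mulVec θ]
    refine congrFun (congrArg _ (funext fun l => ?_)) _
    refine (integral_sub (hY _ (ht i hi).1 l) (hY _ (ht i hi).2 l)).trans ?_
    rw [(hX.sq l).mean _ (ht i hi).1, (hX.sq l).mean _ (ht i hi).2, Matrix.transpose_sub,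
      Matrix.sub_mulVec]
    rfl
  · change (((1 / a) • (F a * S⁻¹)) *ᵥ ((F a)ᵀ *ᵥ θ)) k = _
    rw [Matrix.mulVec_mulVec, Matrix.smul_mul]

/-- Unbiasedness says that M⁻¹ times the sum plus the initial term is the identity. Multiplying by M
and cancelling the initial term, which also occurs in M, leaves the condition on M₀. -/
theorem isUnbiased_discreteEst_iff [IsProbabilityMeasure P] (hε : IsBrownianPair ε P)
    (ha : 0 < a) (hab : a < b)
    (hF : IsC1 a b F) (hM : IsUnit (infoM a b F S).det) (n : ℕ) {t : ℕ → ℝ}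
    (Φ : ℕ → Matrix (Fin p) (Fin 2) ℝ)
    (ht : ∀ i ∈ Finset.Icc 2 n, t i ∈ Set.Icc a b ∧ t (i - 1) ∈ Set.Icc a b) :
    IsUnbiased P (fun θ => discreteEst a b F S n t Φ (obs F R ε θ)) ↔
      infoM0 a b F S = ∑ i ∈ Finset.Icc 2 n, Φ i * S⁻¹ * (F (t i) - F (t (i - 1)))ᵀ := by
  have key := integral_discreteEst (R := R) (S := S) hε ha hab hF n Φ ht
  set A := ∑ i ∈ Finset.Icc 2 n, Φ i * S⁻¹ * (F (t i) - F (t (i - 1)))ᵀ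
  have h1 : IsUnbiased P (fun θ => discreteEst a b F S n t Φ (obs F R ε θ)) ↔
      (infoM a b F S)⁻¹ * (A + (1 / a) • (F a * S⁻¹ * (F a)ᵀ)) = 1 := by
    refine ⟨fun h => Matrix.mulVec_injective (funext fun θ => funext fun i => ?_),
      fun h θ i => ⟨(key θ i).1, ?_⟩⟩
    · rw [← (key θ i).2, (h θ i).2, Matrix.one_mulVec]
    · rw [(key θ i).2, h, Matrix.one_mulVec]
  rw [h1]
  constructor
  · intro h
    have h2 := congrArg (infoM a b F S * ·) h
    simp only [Matrix.mul_nonsing_inv_cancel_left _ _ hM, mul_one] at h2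
    exact (add_right_cancel h2).symm
  · intro h
    rw [← h]
    exact Matrix.nonsing_inv_mul _ hM

end Discrete

/-! ### The optimal weights and the Pythagorean identity. -/

section Blue

/-- The weight function `M⁻¹ Ḟ Σ⁻¹` of the best linear unbiased estimator. -/
noncomputable def blueWeight (a b : ℝ) (F : ℝ → Matrix (Fin p) (Fin 2) ℝ)
    (S : Matrix (Fin 2) (Fin 2) ℝ) (t : ℝ) : Matrix (Fin p) (Fin 2) ℝ :=
  (infoM a b F S)⁻¹ * (matDeriv a b F t * S⁻¹)

/-- The weight `M⁻¹ F(a) Σ⁻¹ / a` of the initial observation in the best linear unbiased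
estimator. -/
noncomputable def blueInitial (a b : ℝ) (F : ℝ → Matrix (Fin p) (Fin 2) ℝ)
    (S : Matrix (Fin 2) (Fin 2) ℝ) : Matrix (Fin p) (Fin 2) ℝ :=
  (infoM a b F S)⁻¹ * ((1 / a) • (F a * S⁻¹))

theorem isL2_blueWeight (hab : a < b) (hF : IsC1 a b F) : IsL2 a b (blueWeight a b F S) :=
  ((hF.isL2_matDeriv hab).mul_const _).const_mul _

theorem blue_ae_eq_linFun [IsProbabilityMeasure P] (hε : IsBrownianPair ε P)
    (ha : 0 < a) (hab : a < b)
    (hF : IsC1 a b F) (θ : Fin p → ℝ) :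
    blue P a b F S (obs F R ε θ)
      =ᵐ[P] linFun P a b (blueWeight a b F S) (blueInitial a b F S) (obs F R ε θ) :=
  (hε.hasBrownianMoments ha hF R θ).mulVec_linFun_ae_eq hab
    ((hF.isL2_matDeriv hab).mul_const S⁻¹) (infoM a b F S)⁻¹

theorem meanMatrix_blue (hab : a < b) (hF : IsC1 a b F)
    (hM : IsUnit (infoM a b F S).det) :
    meanMatrix a b F (blueWeight a b F S) (blueInitial a b F S) = 1 := by
  have hF' := hF.isL2_matDeriv hab
  simp only [meanMatrix, blueWeight, blueInitial, Matrix.mul_assoc (infoM a b F S)⁻¹]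
  rw [matInt_const_mul hab.le _ (IsL2.integrableOn_mul_transpose (hF'.mul_const _) hF'),
    ← Matrix.mul_add, Matrix.smul_mul]
  exact Matrix.nonsing_inv_mul _ hM

theorem transpose_infoM (hS : Sᵀ = S) : (infoM a b F S)ᵀ = infoM a b F S := by
  have h : ∀ A : Matrix (Fin p) (Fin 2) ℝ, (A * S⁻¹ * Aᵀ)ᵀ = A * S⁻¹ * Aᵀ := by
    intro A
    simp only [Matrix.transpose_mul, Matrix.transpose_transpose, Matrix.transpose_nonsing_inv, hS,
      Matrix.mul_assoc]
  simp only [infoM, infoM0, Matrix.transpose_add, Matrix.transpose_smul, ← matInt_transpose, h]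

/-- The optimality condition. In the covariance formula S meets S⁻¹ and a meets 1/a, so what remains
is the mean matrix of (G, H) times M⁻¹. Unbiasedness makes it M⁻¹, independently of G and H. -/
theorem covariance_linFun_blue [IsProbabilityMeasure P] {X : ℝ → Ω → Fin 2 → ℝ} {D : ℝ → Fin 2 → ℝ}
    (hX : HasBrownianMoments P a b X D S) (ha : 0 < a) (hab : a < b)
    (hF : IsC1 a b F) (hS : Sᵀ = S) (hSu : IsUnit S.det)
    {G : ℝ → Matrix (Fin p) (Fin 2) ℝ} {H : Matrix (Fin p) (Fin 2) ℝ} (hG : IsL2 a b G)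
    (hGH : meanMatrix a b F G H = 1) (i j : Fin p) :
    cov[fun ω => linFun P a b G H X ω i,
      fun ω => linFun P a b (blueWeight a b F S) (blueInitial a b F S) X ω j; P]
      = (infoM a b F S)⁻¹ i j := by
  have hF' := hF.isL2_matDeriv hab
  have hMi : ((infoM a b F S)⁻¹)ᵀ = (infoM a b F S)⁻¹ := by
    rw [Matrix.transpose_nonsing_inv, transpose_infoM hS]
  have hSi : (S⁻¹)ᵀ = S⁻¹ := by rw [Matrix.transpose_nonsing_inv, hS]
  have key : ∀ A B : Matrix (Fin p) (Fin 2) ℝ,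
      A * S * ((infoM a b F S)⁻¹ * (B * S⁻¹))ᵀ = A * Bᵀ * (infoM a b F S)⁻¹ := by
    intro A B
    rw [Matrix.transpose_mul, Matrix.transpose_mul, hMi, hSi]
    calc A * S * (S⁻¹ * Bᵀ * (infoM a b F S)⁻¹)
        = A * (S * S⁻¹) * Bᵀ * (infoM a b F S)⁻¹ := by simp only [Matrix.mul_assoc]
      _ = A * Bᵀ * (infoM a b F S)⁻¹ := by rw [Matrix.mul_nonsing_inv _ hSu, Matrix.mul_one]
  rw [hX.covariance_linFun hab hG (isL2_blueWeight hab hF)]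
  have h1 : a • (H * S * (blueInitial a b F S)ᵀ) = H * (F a)ᵀ * (infoM a b F S)⁻¹ := by
    rw [blueInitial, Matrix.mul_smul, Matrix.transpose_smul, Matrix.mul_smul, key, smul_smul,
      mul_one_div_cancel ha.ne', one_smul]
  simp only [h1, blueWeight, key]
  rw [matInt_mul_const hab.le _ (hG.integrableOn_mul_transpose hF'), ← Matrix.add_mul]
  change (meanMatrix a b F G H * (infoM a b F S)⁻¹) i j = _
  rw [hGH, Matrix.one_mul]

/-- Writing B for the optimal functional, cov(T - B) = cov(T) - M⁻¹ - M⁻¹ + M⁻¹. Both T - θ and T -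
B are centred, so their mean squared error matrices are covariances. -/
theorem mse_linFun [IsProbabilityMeasure P] (hε : IsBrownianPair ε P)
    (ha : 0 < a) (hab : a < b)
    (hF : IsC1 a b F) (hM : IsUnit (infoM a b F S).det) (hRS : R * Rᵀ = S) (hSu : IsUnit S.det)
    {G : ℝ → Matrix (Fin p) (Fin 2) ℝ} {H : Matrix (Fin p) (Fin 2) ℝ} (hG : IsL2 a b G)
    (hGH : meanMatrix a b F G H = 1) (θ : Fin p → ℝ) :
    mse P (linFun P a b G H (obs F R ε θ)) (fun _ => θ)
      = mse P (linFun P a b G H (obs F R ε θ)) (blue P a b F S (obs F R ε θ))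
        + (infoM a b F S)⁻¹ := by
  have hS : Sᵀ = S := by rw [← hRS, Matrix.transpose_mul, Matrix.transpose_transpose]
  have hX : HasBrownianMoments P a b (obs F R ε θ) (fun t => (F t)ᵀ *ᵥ θ) S :=
    hRS ▸ hε.hasBrownianMoments ha hF R θ
  have hB := isL2_blueWeight (S := S) hab hF
  have hmB := meanMatrix_blue hab hF hM
  rw [mse_congr (ae_eq_refl _) (blue_ae_eq_linFun hε ha hab hF θ)]
  set T := linFun P a b G H (obs F R ε θ)
  set B := linFun P a b (blueWeight a b F S) (blueInitial a b F S) (obs F R ε θ)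
  have hT2 : ∀ i, MemLp (fun ω => T ω i) 2 P := hX.memLp_linFun hab hG
  have hB2 : ∀ i, MemLp (fun ω => B ω i) 2 P := hX.memLp_linFun hab hB
  have hT1 : ∀ i, ∫ ω, T ω i ∂P = θ i := fun i => by
    rw [integral_linFun_obs hε ha hab hF R θ hG, hGH, Matrix.one_mulVec]
  have hB1 : ∀ i, ∫ ω, B ω i ∂P = θ i := fun i => by
    rw [integral_linFun_obs hε ha hab hF R θ hB, hmB, Matrix.one_mulVec]
  have hTi : ∀ i, Integrable (fun ω => T ω i) P := fun i => (hT2 i).integrable (by norm_num)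
  have hBi : ∀ i, Integrable (fun ω => B ω i) P := fun i => (hB2 i).integrable (by norm_num)
  ext i j
  have hTB : ∀ i j, cov[fun ω => T ω i, fun ω => B ω j; P] = (infoM a b F S)⁻¹ i j :=
    covariance_linFun_blue hX ha hab hF hS hSu hG hGH
  -- The optimal functional is itself linear and unbiased, so the same lemma gives its own
  -- covariance.
  have hBB : ∀ i j, cov[fun ω => B ω i, fun ω => B ω j; P] = (infoM a b F S)⁻¹ i j :=
    covariance_linFun_blue hX ha hab hF hS hSu hB hmB
  -- Symmetry of M⁻¹ is read off from its being a covariance matrix.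
  have hsymm : (infoM a b F S)⁻¹ j i = (infoM a b F S)⁻¹ i j := by
    rw [← hBB, covariance_comm, hBB]
  have hTθ : ∀ k, ∫ ω, (T ω k - θ k) ∂P = 0 := fun k => by
    rw [integral_sub (hTi k) (integrable_const _), hT1]
    simp
  have hTB0 : ∀ k, ∫ ω, (T ω k - B ω k) ∂P = 0 := fun k => by
    rw [integral_sub (hTi k) (hBi k), hT1, hB1, sub_self]
  rw [Matrix.add_apply,
    mse_apply_eq_covariance (V := fun _ => θ) hTθ hT2 (fun _ => memLp_const _),
    mse_apply_eq_covariance hTB0 hT2 hB2,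
    covariance_fun_sub_fun_sub (hT2 i) (hB2 i) (hT2 j) (hB2 j), covariance_comm (fun ω => B ω i),
    hTB, hTB, hBB, hsymm]
  refine (covariance_sub_const_left (hTi i) _).trans ?_
  refine (covariance_sub_const_right (hTi j) _).trans ?_
  ring

end Blue

end TwoGroup

/-! ### Assembly of the three claims. -/

theorem mainTheorem4 {Ω : Type*} [MeasurableSpace Ω] (P : Measure Ω) [IsProbabilityMeasure P]
    (p : ℕ) (a b : ℝ) (ha : 0 < a) (hab : a < b)
    (σ₁ σ₂ ρ : ℝ) (hσ₁ : 0 < σ₁) (hσ₂ : 0 < σ₂) (hρ : ρ ∈ Set.Ioo (-1 : ℝ) 1)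
    (S : Matrix (Fin 2) (Fin 2) ℝ) (hS : S = Sig σ₁ σ₂ ρ)
    (F : ℝ → Matrix (Fin p) (Fin 2) ℝ) (hF : IsC1 a b F)
    (hM : IsUnit (infoM a b F S).det)
    (ε : Fin 2 → ℝ≥0 → Ω → ℝ) (hε : IsBrownianPair ε P)
    (Y : (Fin p → ℝ) → ℝ → Ω → Fin 2 → ℝ) (hY : Y = obs F (sqrtSig σ₁ σ₂ ρ) ε) :
    -- unbiasedness of the discrete estimator
    (∀ (n : ℕ) (t : ℕ → ℝ) (Φ : ℕ → Matrix (Fin p) (Fin 2) ℝ),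
      2 ≤ n → StrictMonoOn t (Set.Icc 1 n) → t 1 = a → t n = b →
        (∑ i ∈ Finset.Icc 2 n, Φ i * S⁻¹ * matInt (t (i - 1)) (t i) (fun s => (matDeriv a b F s)ᵀ)
          = ∑ i ∈ Finset.Icc 2 n, Φ i * S⁻¹ * (F (t i) - F (t (i - 1)))ᵀ) ∧
        (IsUnbiased P (fun θ => discreteEst a b F S n t Φ (Y θ)) ↔
          infoM0 a b F S = ∑ i ∈ Finset.Icc 2 n, Φ i * S⁻¹ * (F (t i) - F (t (i - 1)))ᵀ)) ∧
    -- the continuous time estimator is the best linear unbiased estimator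
    IsBLUE P a b Y (fun θ => blue P a b F S (Y θ)) ∧
    -- mean squared errors of linear unbiased estimators
    (∀ T : (Fin p → ℝ) → Ω → Fin p → ℝ, IsLinearEst P a b Y T → IsUnbiased P T →
      ∀ θ, (∀ j, MemLp (fun ω => T θ ω j) 2 P) ∧
        (∀ j, MemLp (fun ω => blue P a b F S (Y θ) ω j) 2 P) ∧
        mse P (T θ) (fun _ => θ)
          = mse P (T θ) (blue P a b F S (Y θ)) + (infoM a b F S)⁻¹) := by
  subst hY
  obtain ⟨hpos, hdet⟩ := posSemidef_and_isUnit_det_Sig hσ₁ hσ₂ hρ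
  have hRS : sqrtSig σ₁ σ₂ ρ * (sqrtSig σ₁ σ₂ ρ)ᵀ = S := by rw [hS, sqrtSig_mul_transpose hpos]
  have hSu : IsUnit S.det := hS ▸ hdet
  have hBL := fun θ => blue_ae_eq_linFun (S := S) (R := sqrtSig σ₁ σ₂ ρ) hε ha hab hF θ
  have hBw := isL2_blueWeight (S := S) hab hF
  have hmB := meanMatrix_blue hab hF hM
  have hlin : IsLinearEst P a b (obs F (sqrtSig σ₁ σ₂ ρ) ε)
      (fun θ => blue P a b F S (obs F (sqrtSig σ₁ σ₂ ρ) ε θ)) :=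
    ⟨_, _, hBw, hBL⟩
  have hunb : IsUnbiased P (fun θ => blue P a b F S (obs F (sqrtSig σ₁ σ₂ ρ) ε θ)) :=
    ((isUnbiased_linFun_iff hε ha hab hF _ hBw).2 hmB).congr fun θ => (hBL θ).symm
  have hmain : ∀ T : (Fin p → ℝ) → Ω → Fin p → ℝ,
      IsLinearEst P a b (obs F (sqrtSig σ₁ σ₂ ρ) ε) T → IsUnbiased P T →
      ∀ θ, (∀ j, MemLp (fun ω => T θ ω j) 2 P) ∧
        mse P (T θ) (fun _ => θ)
          = mse P (T θ) (blue P a b F S (obs F (sqrtSig σ₁ σ₂ ρ) ε θ)) + (infoM a b F S)⁻¹ := by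
    rintro T ⟨G, H, hG, hT⟩ hTu θ
    have hT' : ∀ θ, T θ =ᵐ[P] linFun P a b G H (obs F (sqrtSig σ₁ σ₂ ρ) ε θ) := hT
    have hGH := (isUnbiased_linFun_iff hε ha hab hF _ hG).1 (hTu.congr hT')
    refine ⟨fun j => ?_, ?_⟩
    · refine MemLp.ae_eq ?_
        ((hε.hasBrownianMoments ha hF (sqrtSig σ₁ σ₂ ρ) θ).memLp_linFun (H := H) hab hG j)
      filter_upwards [hT' θ] with ω hω
      rw [hω]
    · rw [mse_congr (hT' θ) (ae_eq_refl _), mse_congr (hT' θ) (ae_eq_refl _)]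
      exact mse_linFun hε ha hab hF hM hRS hSu hG hGH θ
  have hB2 := fun θ => (hmain _ hlin hunb θ).1
  refine ⟨fun n t Φ hn hmono h1 hnb => ?_, ⟨hlin, hunb, fun T hT hTu θ => ?_⟩,
    fun T hT hTu θ => ⟨(hmain T hT hTu θ).1, hB2 θ, (hmain T hT hTu θ).2⟩⟩
  · have hmem : ∀ i ∈ Set.Icc 1 n, t i ∈ Set.Icc a b := fun i hi =>
      ⟨h1 ▸ hmono.monotoneOn ⟨le_rfl, by omega⟩ hi hi.1,
        hnb ▸ hmono.monotoneOn hi ⟨by omega, le_rfl⟩ hi.2⟩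
    have ht : ∀ i ∈ Finset.Icc 2 n, t i ∈ Set.Icc a b ∧ t (i - 1) ∈ Set.Icc a b := by
      intro i hi
      rw [Finset.mem_Icc] at hi
      exact ⟨hmem i ⟨by omega, hi.2⟩, hmem (i - 1) ⟨by omega, by omega⟩⟩
    refine ⟨Finset.sum_congr rfl fun i hi => ?_, isUnbiased_discreteEst_iff hε ha hab hF hM n Φ ht⟩
    have hi' := Finset.mem_Icc.1 hi
    rw [matInt_matDeriv_transpose hab hF (ht i hi).2.1 (hmono.monotoneOn ⟨by omega, by omega⟩
      ⟨by omega, hi'.2⟩ (Nat.sub_le i 1)) (ht i hi).1.2]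
  -- The identity applied to the optimal estimator itself shows that its mean squared error is M⁻¹;
  -- subtracting leaves the matrix for T - B.
  · have hzero : mse P (blue P a b F S (obs F (sqrtSig σ₁ σ₂ ρ) ε θ))
        (blue P a b F S (obs F (sqrtSig σ₁ σ₂ ρ) ε θ)) = 0 := by
      ext i j
      simp [mse]
    rw [(hmain T hT hTu θ).2, (hmain _ hlin hunb θ).2, hzero, zero_add, add_sub_cancel_right]
    exact posSemidef_mse (hmain T hT hTu θ).1 (hB2 θ)
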